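/- **Setting.** Let $q$ be a prime, $n\ge 2$, $s\in\mathbb F_q^n$, and let $\log$ be the natural logarithm. Let $\sigma>0$ and $t\ge 0$ be real numbers such that $N=t\sigma$ is an integer, and put $D=2t\sigma+1$. For samples $(a_i,c_i)\in\mathbb F_q^n\times\mathbb F_q$, $1\le i\le m$, let $\mathcal F_{\mathrm{LWE}}=\{f(c_i-a_i^{\intercal}x)\}_{1\le i\le m}\subset P=\mathbb F_q[x_1,\dots,x_n]$, where $f(x)=x\prod_{i=1}^{N}(x+i)(x-i)$ has degree $D$. The degree of regularity $d_{\mathrm{reg}}(\mathcal F)$ is the least $d\ge0$ such that the ideal generated by the highest degree components of the elements of $\mathcal F$ contains all homogeneous polynomials of degree $d$. Let $2\le\omega\le 3$ be a linear algebra constant: fix an algorithm (given by arithmetic programs over $\mathbb F_q$ with field operations and zero tests, one for each $q$ and each matrix format) that computes the reduced row echelon form of every $a\times b$ matrix of rank $r$ over every prime field with $O(a\,b\,r^{\omega-2})$ instructions ($r$ being replaced by $1$ for the zero matrix), the implied constant being independent of $q,a,b$. The linear algebra-based Gröbner basis algorithm in degree $d$ repeats the following round, starting from the given system: form the Macaulay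 matrix $M_{\le d}$ of the current system (rows: the products $u\cdot g$ with $g$ in the system, $u$ a monomial and $\deg u+\deg g\le d$; columns: the monomials of degree $\le d$ in descending degree reverse lexicographic (DRL) order), compute its reduced row echelon form, and replace the system by the polynomials given by the nonzero rows. It stops when a round does not change the system, and returns that system. Its time is the sum over all rounds of the number of instructions of the elimination plus the number of coefficients and matrix entries read and written; its memory is the maximal number of field elements stored in a round. **Theorem.** Let $K$ be a constant. 1. *(Complexity.)* Suppose that $m\le K\binom{n+D-1}{D}$ and $d_{\mathrm{reg}}(\mathcal F_{\mathrm{LWE}})=D$. Then the algorithm in degree $2D-1$, applied to $\mathcal F_{\mathrm{LWE}}$, terminates and returns a DRL Gröbner basis of the ideal $(\mathcal F_{\mathrm{LWE}})$. Its time complexity is $$\mathcal O\Big(D^3\cdot 2^{(\omega+3)\cdot 2^{1/\log 2}\cdot(2D-1)^{1/\log 4}\cdot(n-1)^{1-1/\log 4}}\Big)$$ and its memory complexity is $$\mathcal O\Big(D^3\cdot 2^{5\cdot 2^{1/\log 2}\cdot(2D-1)^{1/\log 4}\cdot(n-1)^{1-1/\log 4}}\Big),$$ where the implied constants depend only on $K$,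 $\omega$ and the row reduction algorithm, and not on $q,n,t,\sigma,m$ or the samples. 2. *(Success probability.)* Let $m\le K\binom{n+D-1}{D}$ and let the samples be independent LWE samples $(a_i,\langle s,a_i\rangle+e_i)$, where $a_i\in\mathbb F_q^n$ is uniform and $e_i\in\mathbb Z$ is obtained from a normal random variable with mean $0$ and standard deviation $\sigma$ by a measurable discretization $\delta:\mathbb R\to\mathbb Z$ (such as rounding) with $\delta([-M,M])\subseteq[-M,M]$ for all $M\in\mathbb N$. The algorithm succeeds if all errors satisfy $|e_i|\le t\sigma$ and $s$ is a common zero of the returned polynomials. For fixed $n,\sigma,K$, the probability of success tends to $1$ as $t\to\infty$ (through values with $t\sigma\in\mathbb N$), uniformly in $q,m,s,\delta$; the same holds for the conditional probability of success given $d_{\mathrm{reg}}(\mathcal F_{\mathrm{LWE}})=D$, whenever this event has positive probability. -/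

import Mathlib

open MeasureTheory ProbabilityTheory
open scoped NNReal

/-! ### The degree reverse lexicographic term order -/

/-- Exponent vectors in `n` variables, to be ordered by DRL with `x₁ > x₂ > ⋯ > xₙ`. -/
def DRLExponent (n : ℕ) : Type := Fin n →₀ ℕ

noncomputable instance (n : ℕ) : AddCommMonoid (DRLExponent n) :=
  inferInstanceAs (AddCommMonoid (Fin n →₀ ℕ))

/-- The vector of partial sums `(a₁ + ⋯ + aₙ, a₁ + ⋯ + aₙ₋₁, …, a₁)`; comparing these vectors
lexicographically is DRL, see `drl_lt_iff`. -/
def drlKey {n : ℕ} (a : Fin n →₀ ℕ) : Lex (Fin n → ℕ) :=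
  toLex fun j => ∑ i ∈ Finset.Iic (Fin.rev j), a i

theorem drlKey_add {n : ℕ} (a b : Fin n →₀ ℕ) : drlKey (a + b) = drlKey a + drlKey b := by
  apply ofLex.injective
  funext j
  change ∑ i ∈ Finset.Iic (Fin.rev j), (a + b) i =
    ∑ i ∈ Finset.Iic (Fin.rev j), a i + ∑ i ∈ Finset.Iic (Fin.rev j), b i
  simp [Finset.sum_add_distrib]

theorem sum_Iic_eq_of_drlKey_eq {n : ℕ} {a b : Fin n →₀ ℕ} (h : drlKey a = drlKey b) (i : Fin n) :
    ∑ l ∈ Finset.Iic i, a l = ∑ l ∈ Finset.Iic i, b l := by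
  have := congrFun (congrArg ofLex h) (Fin.rev i)
  simpa [drlKey] using this

theorem drlKey_injective {n : ℕ} : Function.Injective (drlKey (n := n)) := by
  intro a b h
  have h' := sum_Iic_eq_of_drlKey_eq h
  ext i
  induction i using WellFoundedLT.induction with
  | ind i ih =>
    have hi := h' i
    rw [← Finset.Iio_insert, Finset.sum_insert (by simp), Finset.sum_insert (by simp)] at hi
    have : ∑ l ∈ Finset.Iio i, a l = ∑ l ∈ Finset.Iio i, b l :=
      Finset.sum_congr rfl fun l hl => ih l (by simpa using hl)
    omega

noncomputable instance (n : ℕ) : LinearOrder (DRLExponent n) :=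
  LinearOrder.lift' (fun a : DRLExponent n => drlKey (n := n) a) drlKey_injective

theorem DRLExponent.le_def {n : ℕ} (a b : DRLExponent n) :
    a ≤ b ↔ drlKey (n := n) a ≤ drlKey (n := n) b := Iff.rfl

instance (n : ℕ) : IsOrderedAddMonoid (DRLExponent n) where
  add_le_add_left a b h c := by
    rw [DRLExponent.le_def] at h ⊢
    have e₁ : drlKey (n := n) (a + c) = drlKey (n := n) a + drlKey (n := n) c := drlKey_add _ _
    have e₂ : drlKey (n := n) (b + c) = drlKey (n := n) b + drlKey (n := n) c := drlKey_add _ _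
    rw [e₁, e₂]
    exact add_le_add_left h _

instance (n : ℕ) : WellFoundedLT (DRLExponent n) :=
  ⟨InvImage.wf (fun a : DRLExponent n => drlKey (n := n) a) wellFounded_lt⟩

/-- The degree reverse lexicographic term order on `k[x₁, …, xₙ]`. -/
noncomputable def drl (n : ℕ) : MonomialOrder (Fin n) where
  syn := DRLExponent n
  toSyn := { toEquiv := Equiv.refl (Fin n →₀ ℕ), map_add' := fun _ _ => rfl }
  toSyn_monotone a b h := by
    change drlKey a ≤ drlKey b
    exact Pi.toLex_monotone fun j => Finset.sum_le_sum fun i _ => h i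

/-- `x^a < x^b` in DRL iff `deg a < deg b`, or the degrees agree and `aᵢ > bᵢ` at the last
position `i` where `a` and `b` differ. -/
theorem drl_lt_iff {n : ℕ} (a b : Fin n →₀ ℕ) :
    (drl n).toSyn a < (drl n).toSyn b ↔
      a.degree < b.degree ∨
        (a.degree = b.degree ∧ ∃ i, b i < a i ∧ ∀ j, i < j → a j = b j) := by
  have hsum : ∀ (c : Fin n →₀ ℕ) (i : Fin n),
      ∑ l ∈ Finset.Iic i, c l + ∑ l ∈ Finset.Ioi i, c l = c.degree := by
    intro c i
    rw [Finsupp.degree_eq_sum, ← Finset.sum_union (Finset.disjoint_left.2 fun x hx hx' => by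
      simp only [Finset.mem_Iic, Finset.mem_Ioi] at hx hx'; exact absurd hx (not_le.2 hx'))]
    congr 1
    ext x
    simp [le_or_gt]
  have hlt : ∀ a b : Fin n →₀ ℕ, (a.degree < b.degree ∨
      (a.degree = b.degree ∧ ∃ i, b i < a i ∧ ∀ j, i < j → a j = b j)) →
      drlKey a < drlKey b := by
    intro a b h
    have hkey : ∀ i : Fin n, (∀ j, i < j →
          ∑ l ∈ Finset.Iic j, a l = ∑ l ∈ Finset.Iic j, b l) →
        ∑ l ∈ Finset.Iic i, a l < ∑ l ∈ Finset.Iic i, b l → drlKey a < drlKey b := by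
      intro i h₁ h₂
      refine ⟨Fin.rev i, fun j hj => ?_, ?_⟩
      · exact h₁ (Fin.rev j) (by
          have h₃ := Fin.lt_def.1 hj
          rw [Fin.val_rev] at h₃
          rw [Fin.lt_def, Fin.val_rev]
          omega)
      · change ∑ l ∈ Finset.Iic (Fin.rev (Fin.rev i)), a l <
          ∑ l ∈ Finset.Iic (Fin.rev (Fin.rev i)), b l
        simpa using h₂
    rcases h with h | ⟨h, i, hi, hij⟩
    · rcases n with _ | n
      · simp [Finsupp.degree_eq_sum] at h
      · refine hkey (Fin.last n) (fun j hj => absurd hj (not_lt.2 (Fin.le_last j))) ?_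
        have h₁ := hsum a (Fin.last n)
        have h₂ := hsum b (Fin.last n)
        have : Finset.Ioi (Fin.last n) = ∅ := by
          ext x; simp [Fin.le_last]
        simp only [this, Finset.sum_empty, add_zero] at h₁ h₂
        omega
    · have htail : ∀ j, i ≤ j → ∑ l ∈ Finset.Ioi j, a l = ∑ l ∈ Finset.Ioi j, b l := fun j hj =>
        Finset.sum_congr rfl fun l hl => hij l (lt_of_le_of_lt hj (by simpa using hl))
      have hi0 : 0 < i.val := by
        by_contra h0
        have h₁ := hsum a i
        have h₂ := hsum b i
        have : Finset.Iic i = {i} := by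
          ext x
          rw [Finset.mem_Iic, Finset.mem_singleton, Fin.le_def, Fin.ext_iff]
          omega
        simp only [this, Finset.sum_singleton, htail i le_rfl] at h₁ h₂
        omega
      have hi' : Finset.Iic i = insert i (Finset.Iic ⟨i.val - 1, by omega⟩) := by
        ext x
        rw [Finset.mem_insert, Finset.mem_Iic, Finset.mem_Iic, Fin.le_def, Fin.le_def, Fin.ext_iff]
        change x.val ≤ i.val ↔ x.val = i.val ∨ x.val ≤ i.val - 1
        omega
      have hn : i ∉ Finset.Iic (⟨i.val - 1, by omega⟩ : Fin n) := by
        rw [Finset.mem_Iic, Fin.le_def]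
        change ¬ i.val ≤ i.val - 1
        omega
      refine hkey ⟨i.val - 1, by omega⟩ (fun j hj => ?_) ?_
      · have h₁ := hsum a j
        have h₂ := hsum b j
        have h₃ := htail j (by rw [Fin.lt_def] at hj; rw [Fin.le_def]; simp at hj; omega)
        omega
      · have h₁ := hsum a i
        have h₂ := hsum b i
        rw [htail i le_rfl, hi', Finset.sum_insert hn] at h₁
        rw [hi', Finset.sum_insert hn] at h₂
        omega
  constructor
  · intro h
    change drlKey a < drlKey b at h
    by_contra hcon
    push Not at hcon
    obtain ⟨hdeg, hcon⟩ := hcon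
    by_cases hab : a = b
    · exact absurd h (hab ▸ lt_irrefl _)
    refine absurd h (not_lt.2 (hlt b a ?_).le)
    rcases hdeg.lt_or_eq with hd | hd
    · exact Or.inl hd
    refine Or.inr ⟨hd, ?_⟩
    have hne : (Finset.univ.filter fun i => a i ≠ b i).Nonempty := by
      obtain ⟨i, hi⟩ := DFunLike.ne_iff.1 hab
      exact ⟨i, by simpa using hi⟩
    refine ⟨(Finset.univ.filter fun i => a i ≠ b i).max' hne, ?_, ?_⟩
    · have hmem := Finset.max'_mem _ hne
      simp only [Finset.mem_filter, Finset.mem_univ, true_and] at hmem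
      refine lt_of_le_of_ne (not_lt.1 fun hlt' => ?_) hmem
      obtain ⟨j, hj, hj'⟩ := hcon hd.symm _ hlt'
      exact absurd (Finset.le_max' (Finset.univ.filter fun i => a i ≠ b i) j (by simpa using hj'))
        (not_le.2 hj)
    · intro j hj
      by_contra hj'
      exact absurd (Finset.le_max' (Finset.univ.filter fun i => a i ≠ b i) j
        (by simpa using Ne.symm hj')) (not_le.2 hj)
  · exact hlt a b

/-! ### Polynomial systems, degree of regularity, Gröbner bases -/

/-- The highest degree component of a polynomial. -/
noncomputable def topComponent {n : ℕ} {k : Type} [Field k] (f : MvPolynomial (Fin n) k) :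
    MvPolynomial (Fin n) k :=
  MvPolynomial.homogeneousComponent f.totalDegree f

/-- `d_reg(F) = d`: the least degree in which the ideal of the highest degree components of `F`
contains all homogeneous polynomials is (finite and equal to) `d`. -/
def HasDegreeOfRegularity {n : ℕ} {k : Type} [Field k] (F : Set (MvPolynomial (Fin n) k))
    (d : ℕ) : Prop :=
  IsLeast {e : ℕ | ∀ p : MvPolynomial (Fin n) k, p.IsHomogeneous e →
    p ∈ Ideal.span (topComponent '' F)} d

/-- `G` is a Gröbner basis of the ideal `I` with respect to the term order `ord`. -/
def IsGroebnerBasis {n : ℕ} {k : Type} [Field k] (ord : MonomialOrder (Fin n))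
    (G : Set (MvPolynomial (Fin n) k)) (I : Ideal (MvPolynomial (Fin n) k)) : Prop :=
  G.Finite ∧ Ideal.span G = I ∧
    Ideal.span (ord.leadingTerm '' G) =
      Ideal.span (ord.leadingTerm '' (I : Set (MvPolynomial (Fin n) k)))

/-! ### Arithmetic programs over a field

Algebraic computation trees: finite programs over registers holding field elements, with
constants, field operations and zero tests. -/

/-- A program whose outputs are indexed by `o`; `halt out` returns the contents of the
registers `out`. The first argument of an arithmetic instruction is the target register. -/
inductive ArithProg (k o : Type) : Type
  | halt (out : o → ℕ) : ArithProg k o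
  | const (r : ℕ) (c : k) (next : ArithProg k o) : ArithProg k o
  | add (r x y : ℕ) (next : ArithProg k o) : ArithProg k o
  | sub (r x y : ℕ) (next : ArithProg k o) : ArithProg k o
  | mul (r x y : ℕ) (next : ArithProg k o) : ArithProg k o
  | div (r x y : ℕ) (next : ArithProg k o) : ArithProg k o
  | ifZero (x : ℕ) (zero nonzero : ArithProg k o) : ArithProg k o

namespace ArithProg

variable {k o : Type} [Field k] [DecidableEq k]

/-- The output of a program started on the given register contents. -/
def eval : ArithProg k o → (ℕ → k) → o → k
  | halt out, ρ => fun i => ρ (out i)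
  | const r c p, ρ => p.eval (Function.update ρ r c)
  | add r x y p, ρ => p.eval (Function.update ρ r (ρ x + ρ y))
  | sub r x y p, ρ => p.eval (Function.update ρ r (ρ x - ρ y))
  | mul r x y p, ρ => p.eval (Function.update ρ r (ρ x * ρ y))
  | div r x y p, ρ => p.eval (Function.update ρ r (ρ x / ρ y))
  | ifZero x p p', ρ => if ρ x = 0 then p.eval ρ else p'.eval ρ

/-- The number of instructions executed. -/
def steps : ArithProg k o → (ℕ → k) → ℕ
  | halt _, _ => 0
  | const r c p, ρ => p.steps (Function.update ρ r c) + 1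
  | add r x y p, ρ => p.steps (Function.update ρ r (ρ x + ρ y)) + 1
  | sub r x y p, ρ => p.steps (Function.update ρ r (ρ x - ρ y)) + 1
  | mul r x y p, ρ => p.steps (Function.update ρ r (ρ x * ρ y)) + 1
  | div r x y p, ρ => p.steps (Function.update ρ r (ρ x / ρ y)) + 1
  | ifZero x p p', ρ => (if ρ x = 0 then p.steps ρ else p'.steps ρ) + 1

/-- The registers accessed during the execution. -/
def registers [Fintype o] : ArithProg k o → (ℕ → k) → Finset ℕ
  | halt out, _ => Finset.univ.image out
  | const r c p, ρ => {r} ∪ p.registers (Function.update ρ r c)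
  | add r x y p, ρ => {r, x, y} ∪ p.registers (Function.update ρ r (ρ x + ρ y))
  | sub r x y p, ρ => {r, x, y} ∪ p.registers (Function.update ρ r (ρ x - ρ y))
  | mul r x y p, ρ => {r, x, y} ∪ p.registers (Function.update ρ r (ρ x * ρ y))
  | div r x y p, ρ => {r, x, y} ∪ p.registers (Function.update ρ r (ρ x / ρ y))
  | ifZero x p p', ρ => {x} ∪ if ρ x = 0 then p.registers ρ else p'.registers ρ

end ArithProg

/-- Initial register contents for an `a × b` input matrix: the entries in row-major order in
registers `0, …, ab - 1`, and `0` elsewhere. -/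
def loadMatrix {k : Type} [Field k] {a b : ℕ} (A : Matrix (Fin a) (Fin b) k) : ℕ → k :=
  fun r => if h : r < a * b then
    A ⟨r / b, Nat.div_lt_of_lt_mul (by rwa [mul_comm] at h)⟩
      ⟨r % b, Nat.mod_lt _ (Nat.pos_of_ne_zero fun hb => by simp [hb] at h)⟩
  else 0

/-! ### Gaussian elimination and linear algebra exponents -/

/-- An algorithm for Gaussian elimination over prime fields: for every prime `q` and every matrix
format, a program that computes the reduced row echelon form. -/
structure RowReduction where
  prog (q : ℕ) [Fact q.Prime] (a b : ℕ) : ArithProg (ZMod q) (Fin a × Fin b)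
  isReducedRowEchelon (q : ℕ) [Fact q.Prime] (a b : ℕ) (A : Matrix (Fin a) (Fin b) (ZMod q)) :
    (Matrix.of fun i j => (prog q a b).eval (loadMatrix A) (i, j)).IsReducedRowEchelon
  rowSpace_eq (q : ℕ) [Fact q.Prime] (a b : ℕ) (A : Matrix (Fin a) (Fin b) (ZMod q)) :
    Submodule.span (ZMod q)
      (Set.range fun i => fun j => (prog q a b).eval (loadMatrix A) (i, j)) =
    Submodule.span (ZMod q) (Set.range fun i => A i)

namespace RowReduction

variable (E : RowReduction) {q : ℕ} [Fact q.Prime]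

/-- The reduced row echelon form, as computed by `E`. -/
def rref {a b : ℕ} (A : Matrix (Fin a) (Fin b) (ZMod q)) : Matrix (Fin a) (Fin b) (ZMod q) :=
  Matrix.of fun i j => (E.prog q a b).eval (loadMatrix A) (i, j)

/-- The number of instructions `E` executes on `A`. -/
def steps {a b : ℕ} (A : Matrix (Fin a) (Fin b) (ZMod q)) : ℕ :=
  (E.prog q a b).steps (loadMatrix A)

/-- The number of registers `E` occupies on `A`, those of the input matrix included. -/
def space {a b : ℕ} (A : Matrix (Fin a) (Fin b) (ZMod q)) : ℕ :=
  (Finset.range (a * b) ∪ (E.prog q a b).registers (loadMatrix A)).card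

/-- `ω` is a linear algebra constant for `E`: an `a × b` matrix of rank `r` is reduced in
`O(a · b · r^(ω-2))` steps, with one constant for all prime fields. (The rank is replaced by `1`
for the zero matrix.) -/
def HasExponent (E : RowReduction) (ω : ℝ) : Prop :=
  ∃ c : ℝ, ∀ (q : ℕ) [Fact q.Prime] (a b : ℕ) (A : Matrix (Fin a) (Fin b) (ZMod q)),
    (E.steps A : ℝ) ≤ c * a * b * (max A.rank 1 : ℝ) ^ (ω - 2)

end RowReduction

/-! ### The linear algebra-based Gröbner basis algorithm -/

/-- The exponents of the monomials of degree `≤ d` in `n` variables, in descending DRL order. -/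
noncomputable def drlMonomials (n d : ℕ) : List (Fin n →₀ ℕ) :=
  ((((Finset.range (d + 1)).biUnion fun e => Finset.univ.finsuppAntidiag e).map
    (drl n).toSyn.toEquiv.toEmbedding).sort (· ≥ ·)).map (drl n).toSyn.symm

/-- The polynomials `s · f` with `f` in the system `F`, `s` a monomial and `deg(s · f) ≤ d`. -/
noncomputable def macaulayRows {n : ℕ} {k : Type} [Field k] (d : ℕ)
    (F : List (MvPolynomial (Fin n) k)) : List (MvPolynomial (Fin n) k) :=
  F.flatMap fun f => ((drlMonomials n d).filter fun s => s.degree + f.totalDegree ≤ d).map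
    fun s => MvPolynomial.monomial s 1 * f

/-- The Macaulay matrix `M_{≤ d}` of the system `F` with respect to DRL. -/
noncomputable def macaulayMatrix {n : ℕ} {k : Type} [Field k] (d : ℕ)
    (F : List (MvPolynomial (Fin n) k)) :
    Matrix (Fin (macaulayRows d F).length) (Fin (drlMonomials n d).length) k :=
  Matrix.of fun i j => ((macaulayRows d F).get i).coeff ((drlMonomials n d).get j)

namespace RowReduction

variable (E : RowReduction) {q n : ℕ} [Fact q.Prime]

open Classical in
/-- One round: Gaussian elimination on `M_{≤ d}`; the result is the list of the polynomials given
by the nonzero rows, a basis of the row space of `M_{≤ d}`. -/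
noncomputable def round (d : ℕ) (F : List (MvPolynomial (Fin n) (ZMod q))) :
    List (MvPolynomial (Fin n) (ZMod q)) :=
  ((List.finRange (macaulayRows d F).length).map fun i =>
    ∑ j, MvPolynomial.monomial ((drlMonomials n d).get j) (E.rref (macaulayMatrix d F) i j)).filter
      fun g => g ≠ 0

/-- The polynomial system after `j` rounds. -/
noncomputable def system (d : ℕ) (F : List (MvPolynomial (Fin n) (ZMod q))) (j : ℕ) :
    List (MvPolynomial (Fin n) (ZMod q)) :=
  (E.round d)^[j] F

/-- The algorithm stops as soon as a round returns the system it was given. -/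
def Terminates (d : ℕ) (F : List (MvPolynomial (Fin n) (ZMod q))) : Prop :=
  ∃ j, E.system d F (j + 1) = E.system d F j

/-- The index of the last system to which a round is applied. -/
noncomputable def lastRound (d : ℕ) (F : List (MvPolynomial (Fin n) (ZMod q))) : ℕ :=
  sInf {j | E.system d F (j + 1) = E.system d F j}

/-- The output of the algorithm: the stable system, i.e. the rows of the final Macaulay matrix
after elimination. -/
noncomputable def output (d : ℕ) (F : List (MvPolynomial (Fin n) (ZMod q))) :
    List (MvPolynomial (Fin n) (ZMod q)) :=
  E.system d F (E.lastRound d F)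

/-- The time of one round: reading the coefficients of the system, writing the Macaulay matrix,
eliminating, and reading off and comparing the echelon form. -/
noncomputable def roundTime (d : ℕ) (F : List (MvPolynomial (Fin n) (ZMod q))) : ℕ :=
  F.length * (drlMonomials n d).length
    + (macaulayRows d F).length * (drlMonomials n d).length
    + E.steps (macaulayMatrix d F)
    + (macaulayRows d F).length * (drlMonomials n d).length

/-- The number of field elements stored in one round: the system and the registers used by the
elimination of its Macaulay matrix. -/
noncomputable def roundSpace (d : ℕ) (F : List (MvPolynomial (Fin n) (ZMod q))) : ℕ :=
  F.length * (drlMonomials n d).length + E.space (macaulayMatrix d F)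

/-- Total running time. -/
noncomputable def time (d : ℕ) (F : List (MvPolynomial (Fin n) (ZMod q))) : ℕ :=
  ∑ j ∈ Finset.range (E.lastRound d F + 1), E.roundTime d (E.system d F j)

/-- Peak memory. -/
noncomputable def memory (d : ℕ) (F : List (MvPolynomial (Fin n) (ZMod q))) : ℕ :=
  (Finset.range (E.lastRound d F + 1)).sup fun j => E.roundSpace d (E.system d F j)

end RowReduction

/-! ### Learning with errors -/

/-- The error polynomial `x · ∏_{i=1}^{N} (x + i)(x - i)` of degree `2N + 1`. -/
noncomputable def lweErrorPoly (q N : ℕ) [Fact q.Prime] : Polynomial (ZMod q) :=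
  Polynomial.X * ∏ i ∈ Finset.Icc 1 N,
    ((Polynomial.X + Polynomial.C (i : ZMod q)) * (Polynomial.X - Polynomial.C (i : ZMod q)))

/-- The LWE polynomial system `f(cᵢ - aᵢᵀ x)`, `1 ≤ i ≤ m`, of the samples `(aᵢ, cᵢ)`. -/
noncomputable def lweSystem {q n m : ℕ} [Fact q.Prime] (N : ℕ)
    (S : Fin m → (Fin n → ZMod q) × ZMod q) : List (MvPolynomial (Fin n) (ZMod q)) :=
  List.ofFn fun i => Polynomial.aeval
    (MvPolynomial.C (S i).2 - ∑ j, MvPolynomial.C ((S i).1 j) * MvPolynomial.X j)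
    (lweErrorPoly q N)

/-- The LWE sample `(a, ⟨s, a⟩ + e)`. -/
def lweSample {q n : ℕ} (s : Fin n → ZMod q) (w : (Fin n → ZMod q) × ℤ) :
    (Fin n → ZMod q) × ZMod q :=
  (w.1, s ⬝ᵥ w.1 + (w.2 : ZMod q))

/-- The law of the choices `(aᵢ, eᵢ)` behind `m` independent LWE samples: `aᵢ` is uniform and
`eᵢ` has law `χ`. -/
noncomputable def lweChoices (q n m : ℕ) [Fact q.Prime] (χ : Measure ℤ) :
    Measure (Fin m → (Fin n → ZMod q) × ℤ) :=
  Measure.pi fun _ => (uniformOn (Set.univ : Set (Fin n → ZMod q))).prod χ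

/-- A discretization `ℝ → ℤ` of the error (such as rounding to a nearest integer, or truncation):
it maps each interval `[-N, N]`, `N ∈ ℕ`, into itself. -/
def IsDiscretization (δ : ℝ → ℤ) : Prop :=
  Measurable δ ∧ ∀ (x : ℝ) (N : ℕ), |x| ≤ N → |δ x| ≤ N

/-- The error distribution: `N(0, σ)` (`σ` the standard deviation), discretized by `δ`. -/
noncomputable def gaussianError (σ : ℝ≥0) (δ : ℝ → ℤ) : Measure ℤ :=
  (gaussianReal 0 (σ ^ 2)).map δ

/-- The outcomes for which the LWE polynomial system has degree of regularity `D`. -/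
def lweRegular {q n : ℕ} [Fact q.Prime] (m N D : ℕ) (s : Fin n → ZMod q) :
    Set (Fin m → (Fin n → ZMod q) × ℤ) :=
  {w | HasDegreeOfRegularity {f | f ∈ lweSystem N fun i => lweSample s (w i)} D}

/-- The outcomes for which the algorithm, run in degree `d`, succeeds: all errors lie in
`[-N, N]`, and the secret is a zero of the computed basis. -/
def lweSuccess (E : RowReduction) {q n : ℕ} [Fact q.Prime] (m N d : ℕ) (s : Fin n → ZMod q) :
    Set (Fin m → (Fin n → ZMod q) × ℤ) :=
  {w | (∀ i, |(w i).2| ≤ N) ∧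
    ∀ g ∈ E.output d (lweSystem N fun i => lweSample s (w i)), MvPolynomial.eval s g = 0}

/-! Correctness. After a round the system is a reduced echelon basis, hence determined by its span.
The spans increase inside the space of polynomials of degree at most `d`, so the system stabilizes
(`exists_system_stable`). The span `V` of the stable system is closed under multiplication by
monomials as long as the degree bound stays at most `d` (`monomial_mul_mem_span_output`).

By the assumption on the degree of regularity, `V` contains, for each monomial `u` of degree `D`, a
polynomial with top component `u` (`exists_mem_of_mem_span_topComponent`). Rewriting by these
polynomials turns multiplication by each variable into an operator on the polynomials of degree less
than `D`, modulo the elements of `V` of such degree. As in the theory of border bases, closure of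
`V` up to degree `D + 1` makes these operators commute, so the quotient is a module over the
polynomial ring in which the class of 1 is killed by the whole ideal. Hence every element of the
ideal of degree less than `D` already lies in `V` (`mem_of_mem_ideal_of_totalDegree_le`). Leading
monomials in degree at least `D` are divisible by some `u`, those in lower degree come from `V`, and
the Gröbner property follows (`isGroebnerBasis_of_closed`).

Cost. Let `L` be the number of monomials of degree at most `2D - 1`. There are `O(L)` rounds. Each
reduces a matrix with `O(L ^ 2)` rows, `L` columns and rank at most `L`, which gives time `O(L ^ (ω
+ 2))` and memory `O(L ^ (ω + 1))`. It remains to estimate `L`: up to a factor `2D` it is a binomial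
coefficient, bounded by a weighted geometric mean in the exponent (`choose_le_two_rpow`). The unit
added to the power of `L` in the stated exponents absorbs both the loss of 1.15 in that estimate and
the surplus powers of `D`.

Success. If all errors are at most `N` in absolute value, the secret is a zero of the input, hence
of everything the algorithm derives. The Gaussian tail is exponentially small in `N`, while the
number of samples is polynomial in `N`, so Bernoulli's inequality suffices. For the conditional
statement, positive regularity depends only on the vectors `aᵢ` once the errors are small, and these
vectors are independent of the errors (`measureReal_pi_prod_inter`). -/

/-! ### Reduced systems of polynomials -/

/-- A list of monic polynomials with strictly decreasing leading monomials, each of which occurs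
in no other polynomial of the list. -/
structure IsReducedSystem {σ k : Type} [Field k] (ord : MonomialOrder σ)
    (G : List (MvPolynomial σ k)) : Prop where
  monic : ∀ g ∈ G, ord.leadingCoeff g = 1
  pairwise : G.Pairwise fun f g => ord.toSyn (ord.degree g) < ord.toSyn (ord.degree f)
  coeff_eq_zero : ∀ f ∈ G, ∀ g ∈ G, f ≠ g → g.coeff (ord.degree f) = 0

namespace IsReducedSystem

variable {σ k : Type} [Field k] {ord : MonomialOrder σ} {G G' : List (MvPolynomial σ k)}

theorem nodup (hG : IsReducedSystem ord G) : G.Nodup :=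
  hG.pairwise.imp fun {_ _} h e => by rw [e] at h; exact lt_irrefl _ h

-- Taking the coefficients at the leading monomials is dual to the basis `G`: each leading monomial
-- has coefficient 1 in its own polynomial and 0 in all others.
open Classical in
theorem eq_sum (hG : IsReducedSystem ord G) {h : MvPolynomial σ k}
    (hh : h ∈ Submodule.span k {g | g ∈ G}) :
    h = ∑ g ∈ G.toFinset, h.coeff (ord.degree g) • g := by
  induction hh using Submodule.span_induction with
  | mem f hf =>
    rw [Finset.sum_eq_single f]
    · have := hG.monic f hf
      rw [MonomialOrder.leadingCoeff] at this
      rw [this, one_smul]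
    · intro g hg hne
      rw [hG.coeff_eq_zero g (by simpa using hg) f hf hne, zero_smul]
    · intro h
      exact absurd (by simpa using hf) h
  | zero => simp
  | add x y _ _ hx hy =>
    conv_lhs => rw [hx, hy]
    simp [add_smul, Finset.sum_add_distrib]
  | smul a x _ hx =>
    conv_lhs => rw [hx]
    simp [Finset.smul_sum, smul_smul]

/-- The leading coefficient of `h` comes from some `g` in the expansion `eq_sum`. The leading
monomial of `g` then occurs in `h`, and that of `h` occurs in `g`, so each is at most the other. -/
theorem exists_degree_eq (hG : IsReducedSystem ord G) {h : MvPolynomial σ k}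
    (hh : h ∈ Submodule.span k {g | g ∈ G}) (h0 : h ≠ 0) :
    ∃ g ∈ G, ord.degree g = ord.degree h := by
  classical
  have hc : h.coeff (ord.degree h) ≠ 0 := ord.coeff_degree_ne_zero_iff.2 h0
  rw [hG.eq_sum hh, MvPolynomial.coeff_sum, ← hG.eq_sum hh] at hc
  obtain ⟨g, hg, hg'⟩ := Finset.exists_ne_zero_of_sum_ne_zero hc
  rw [MvPolynomial.coeff_smul, smul_eq_mul] at hg'
  refine ⟨g, by simpa using hg, ord.toSyn.injective (le_antisymm ?_ ?_)⟩
  · exact ord.le_degree (MvPolynomial.mem_support_iff.2 (left_ne_zero_of_mul hg'))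
  · exact ord.le_degree (MvPolynomial.mem_support_iff.2 (right_ne_zero_of_mul hg'))

/-- This is the uniqueness of the reduced row echelon form. The element of `G'` with the same
leading monomial as `g` differs from `g` by an element of the span whose coefficients at all leading
monomials vanish. -/
theorem mem_of_span_eq (hG : IsReducedSystem ord G) (hG' : IsReducedSystem ord G')
    (h : Submodule.span k {g | g ∈ G} = Submodule.span k {g | g ∈ G'})
    {g : MvPolynomial σ k} (hg : g ∈ G) : g ∈ G' := by
  classical
  have ne0 : ∀ {G : List (MvPolynomial σ k)}, IsReducedSystem ord G → ∀ f ∈ G, f ≠ 0 := by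
    intro G hG f hf e
    have := hG.monic f hf
    simp [e] at this
  have hgG' : g ∈ Submodule.span k {g | g ∈ G'} := h ▸ Submodule.subset_span hg
  obtain ⟨g', hg', hd⟩ := hG'.exists_degree_eq hgG' (ne0 hG g hg)
  have hg'G : g' ∈ Submodule.span k {g | g ∈ G} := h ▸ Submodule.subset_span hg'
  have hsub : g - g' ∈ Submodule.span k {g | g ∈ G'} :=
    Submodule.sub_mem _ hgG' (Submodule.subset_span hg')
  have hz : g - g' = 0 := by
    rw [hG'.eq_sum hsub]
    refine Finset.sum_eq_zero fun f hf => ?_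
    have hf : f ∈ G' := by simpa using hf
    suffices (g - g').coeff (ord.degree f) = 0 by rw [this, zero_smul]
    rw [MvPolynomial.coeff_sub]
    by_cases hfg : f = g'
    · have h₁ := hG.monic g hg
      have h₂ := hG'.monic g' hg'
      rw [MonomialOrder.leadingCoeff] at h₁ h₂
      rw [hfg, h₂, hd, h₁, sub_self]
    · have hfG : f ∈ Submodule.span k {g | g ∈ G} := h ▸ Submodule.subset_span hf
      -- The leading monomial of `f` also leads some `f'` in `G` other than `g`, so it occurs in
      -- neither `g` nor `g'`.
      obtain ⟨f', hf', hd'⟩ := hG.exists_degree_eq hfG (ne0 hG' f hf)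
      have hne : f' ≠ g := by
        intro e
        apply hfg
        by_contra hne
        have h₁ := hG'.coeff_eq_zero f hf g' hg' hne
        rw [← hd', e, ← hd] at h₁
        have h₂ := hG'.monic g' hg'
        rw [MonomialOrder.leadingCoeff, h₁] at h₂
        exact zero_ne_one h₂
      rw [hG'.coeff_eq_zero f hf g' hg' hfg, ← hd', hG.coeff_eq_zero f' hf' g hg hne, sub_zero]
  rwa [sub_eq_zero.1 hz]

/-- A subspace is spanned by at most one reduced system. -/
theorem eq_of_span_eq (hG : IsReducedSystem ord G) (hG' : IsReducedSystem ord G')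
    (h : Submodule.span k {g | g ∈ G} = Submodule.span k {g | g ∈ G'}) : G = G' :=
  List.Perm.eq_of_pairwise (fun _ _ _ _ h₁ h₂ => absurd (h₁.trans h₂) (lt_irrefl _))
    hG.pairwise hG'.pairwise
    ((List.perm_ext_iff_of_nodup hG.nodup hG'.nodup).2 fun _ =>
      ⟨hG.mem_of_span_eq hG' h, hG'.mem_of_span_eq hG h.symm⟩)

end IsReducedSystem

/-! ### The monomials of bounded degree -/

theorem drl_degree_le_of_le {n : ℕ} {a b : Fin n →₀ ℕ} (h : (drl n).toSyn a ≤ (drl n).toSyn b) :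
    a.degree ≤ b.degree := by
  by_contra hlt
  exact absurd ((drl_lt_iff b a).2 (Or.inl (not_le.1 hlt))) (not_lt.2 h)

theorem degree_le_totalDegree {σ k : Type} [Field k] {f : MvPolynomial σ k} {a : σ →₀ ℕ}
    (ha : f.coeff a ≠ 0) : a.degree ≤ f.totalDegree :=
  MvPolynomial.le_totalDegree (MvPolynomial.mem_support_iff.2 ha)

theorem totalDegree_le_of_coeff {σ k : Type} [Field k] {f : MvPolynomial σ k} {d : ℕ}
    (h : ∀ a, f.coeff a ≠ 0 → a.degree ≤ d) : f.totalDegree ≤ d :=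
  Finset.sup_le fun a ha => h a (MvPolynomial.mem_support_iff.1 ha)

theorem totalDegree_eq_drl_degree {n : ℕ} {k : Type} [Field k] (f : MvPolynomial (Fin n) k) :
    f.totalDegree = ((drl n).degree f).degree := by
  by_cases hf : f = 0
  · simp [hf]
  · refine le_antisymm (totalDegree_le_of_coeff fun a ha => ?_)
      (degree_le_totalDegree ((drl n).coeff_degree_ne_zero_iff.2 hf))
    exact drl_degree_le_of_le ((drl n).le_degree (MvPolynomial.mem_support_iff.2 ha))

theorem mem_drlMonomials {n d : ℕ} {a : Fin n →₀ ℕ} : a ∈ drlMonomials n d ↔ a.degree ≤ d := by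
  unfold drlMonomials
  rw [List.mem_map]
  simp only [Finset.mem_sort, Finset.mem_map]
  constructor
  · rintro ⟨_, ⟨b, hb, rfl⟩, rfl⟩
    have : (drl n).toSyn.symm ((drl n).toSyn.toEquiv.toEmbedding b) = b :=
      (drl n).toSyn.symm_apply_apply b
    rw [this, Finsupp.degree_eq_sum]
    simp only [Finset.mem_biUnion, Finset.mem_range, Finset.mem_finsuppAntidiag] at hb
    obtain ⟨e, he, hb, -⟩ := hb
    exact hb.trans_le (Nat.lt_succ_iff.1 he)
  · intro h
    refine ⟨_, ⟨a, ?_, rfl⟩, (drl n).toSyn.symm_apply_apply a⟩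
    simp only [Finset.mem_biUnion, Finset.mem_range, Finset.mem_finsuppAntidiag]
    exact ⟨a.degree, by omega, by rw [Finsupp.degree_eq_sum], Finset.subset_univ _⟩

theorem length_drlMonomials (n d : ℕ) : (drlMonomials n d).length = (d + n).choose n := by
  unfold drlMonomials
  rw [List.length_map, Finset.length_sort, Finset.card_map, Finset.card_biUnion]
  · simp_rw [Finset.card_finsuppAntidiag_nat_eq_multichoose, Finset.card_univ, Fintype.card_fin]
    exact Nat.sum_range_multichoose d n
  · intro x _ y _ hxy
    refine Finset.disjoint_left.2 fun a ha ha' => ?_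
    simp only [Finset.mem_finsuppAntidiag] at ha ha'
    exact hxy (ha.1.symm.trans ha'.1)

theorem pairwise_drlMonomials (n d : ℕ) :
    (drlMonomials n d).Pairwise fun a b => (drl n).toSyn b < (drl n).toSyn a := by
  unfold drlMonomials
  rw [List.pairwise_map]
  have h₁ := Finset.pairwise_sort ((((Finset.range (d + 1)).biUnion fun e =>
    (Finset.univ : Finset (Fin n)).finsuppAntidiag e).map
      (drl n).toSyn.toEquiv.toEmbedding)) (· ≥ ·)
  have h₂ := Finset.sort_nodup ((((Finset.range (d + 1)).biUnion fun e =>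
    (Finset.univ : Finset (Fin n)).finsuppAntidiag e).map
      (drl n).toSyn.toEquiv.toEmbedding)) (· ≥ ·)
  refine (h₁.and h₂).imp fun {a b} h => ?_
  rw [AddEquiv.apply_symm_apply, AddEquiv.apply_symm_apply]
  exact lt_of_le_of_ne h.1 h.2.symm

theorem drlMonomials_get_lt_iff {n d : ℕ} (i j : Fin (drlMonomials n d).length) :
    (drl n).toSyn ((drlMonomials n d).get j) < (drl n).toSyn ((drlMonomials n d).get i) ↔
      i < j := by
  have h := List.pairwise_iff_get.1 (pairwise_drlMonomials n d)
  refine ⟨fun hlt => ?_, fun hij => h i j hij⟩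
  by_contra hij
  rcases (not_lt.1 hij).lt_or_eq with h' | h'
  · exact absurd (h j i h') (not_lt.2 hlt.le)
  · rw [h'] at hlt
    exact lt_irrefl _ hlt

theorem drlMonomials_get_injective (n d : ℕ) : Function.Injective (drlMonomials n d).get := by
  intro i j h
  by_contra hne
  rcases lt_or_gt_of_ne hne with h' | h'
  · have := (drlMonomials_get_lt_iff i j).2 h'
    rw [h] at this
    exact lt_irrefl _ this
  · have := (drlMonomials_get_lt_iff j i).2 h'
    rw [h] at this
    exact lt_irrefl _ this

/-- Leading monomials are distinct. This keeps the systems small after the first round, whatever the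
size of the input. -/
theorem IsReducedSystem.length_le {n d : ℕ} {k : Type} [Field k]
    {G : List (MvPolynomial (Fin n) k)} (hG : IsReducedSystem (drl n) G)
    (hd : ∀ g ∈ G, g.totalDegree ≤ d) : G.length ≤ (drlMonomials n d).length := by
  rw [← List.length_map (f := (drl n).degree) (as := G)]
  refine (List.subperm_of_subset ?_ ?_).length_le
  · rw [List.Nodup, List.pairwise_map]
    exact hG.pairwise.imp fun {_ _} h e => by rw [e] at h; exact lt_irrefl _ h
  · intro a ha
    obtain ⟨g, hg, rfl⟩ := List.mem_map.1 ha
    rw [mem_drlMonomials, ← totalDegree_eq_drl_degree]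
    exact hd g hg

/-! ### Rows of Macaulay matrices as polynomials -/

section MacaulayRows

variable {n : ℕ} {k : Type} [Field k]

/-- The polynomial of degree at most `d` with the given coefficients. -/
noncomputable def polyOfRow (n d : ℕ) (k : Type) [Field k] :
    (Fin (drlMonomials n d).length → k) →ₗ[k] MvPolynomial (Fin n) k :=
  ∑ j, (MvPolynomial.monomial ((drlMonomials n d).get j)) ∘ₗ LinearMap.proj j

theorem polyOfRow_apply {d : ℕ} (v : Fin (drlMonomials n d).length → k) :
    polyOfRow n d k v = ∑ j, MvPolynomial.monomial ((drlMonomials n d).get j) (v j) := by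
  simp [polyOfRow, LinearMap.sum_apply]

theorem coeff_polyOfRow {d : ℕ} (v : Fin (drlMonomials n d).length → k)
    (j : Fin (drlMonomials n d).length) :
    (polyOfRow n d k v).coeff ((drlMonomials n d).get j) = v j := by
  classical
  rw [polyOfRow_apply, MvPolynomial.coeff_sum, Finset.sum_eq_single j]
  · simp
  · intro i _ hij
    rw [MvPolynomial.coeff_monomial, if_neg fun h => hij (drlMonomials_get_injective n d h)]
  · simp

theorem exists_get_of_coeff_polyOfRow {d : ℕ} {v : Fin (drlMonomials n d).length → k}
    {a : Fin n →₀ ℕ} (h : (polyOfRow n d k v).coeff a ≠ 0) :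
    ∃ j, (drlMonomials n d).get j = a := by
  classical
  rw [polyOfRow_apply, MvPolynomial.coeff_sum] at h
  obtain ⟨j, _, hj⟩ := Finset.exists_ne_zero_of_sum_ne_zero h
  rw [MvPolynomial.coeff_monomial] at hj
  exact ⟨j, by by_contra hne; exact hj (if_neg hne)⟩

theorem totalDegree_polyOfRow_le {d : ℕ} (v : Fin (drlMonomials n d).length → k) :
    (polyOfRow n d k v).totalDegree ≤ d := by
  refine totalDegree_le_of_coeff fun a ha => ?_
  obtain ⟨j, rfl⟩ := exists_get_of_coeff_polyOfRow ha
  exact mem_drlMonomials.1 (List.get_mem _ j)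

theorem polyOfRow_coeff {d : ℕ} {f : MvPolynomial (Fin n) k} (hf : f.totalDegree ≤ d) :
    polyOfRow n d k (fun j => f.coeff ((drlMonomials n d).get j)) = f := by
  ext a
  by_cases ha : a.degree ≤ d
  · obtain ⟨j, rfl⟩ := List.mem_iff_get.1 (mem_drlMonomials.2 ha)
    rw [coeff_polyOfRow]
  · have h₁ : f.coeff a = 0 := by
      by_contra h
      exact ha ((degree_le_totalDegree h).trans hf)
    rw [h₁]
    by_contra h
    obtain ⟨j, rfl⟩ := exists_get_of_coeff_polyOfRow h
    exact ha (mem_drlMonomials.1 (List.get_mem _ j))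

theorem mem_macaulayRows {d : ℕ} {F : List (MvPolynomial (Fin n) k)} {p : MvPolynomial (Fin n) k} :
    p ∈ macaulayRows d F ↔ ∃ f ∈ F, ∃ s : Fin n →₀ ℕ, s.degree + f.totalDegree ≤ d ∧
      MvPolynomial.monomial s 1 * f = p := by
  simp only [macaulayRows, List.mem_flatMap, List.mem_map, List.mem_filter, mem_drlMonomials,
    decide_eq_true_eq]
  constructor
  · rintro ⟨f, hf, s, ⟨_, h⟩, rfl⟩
    exact ⟨f, hf, s, h, rfl⟩
  · rintro ⟨f, hf, s, h, rfl⟩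
    exact ⟨f, hf, s, ⟨by omega, h⟩, rfl⟩

theorem totalDegree_monomial_mul_le (s : Fin n →₀ ℕ) (f : MvPolynomial (Fin n) k) :
    (MvPolynomial.monomial s (1 : k) * f).totalDegree ≤ s.degree + f.totalDegree :=
  (MvPolynomial.totalDegree_mul _ _).trans
    (Nat.add_le_add_right (MvPolynomial.totalDegree_monomial_le _ _) _)

theorem totalDegree_le_of_mem_macaulayRows {d : ℕ} {F : List (MvPolynomial (Fin n) k)}
    {p : MvPolynomial (Fin n) k} (hp : p ∈ macaulayRows d F) : p.totalDegree ≤ d := by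
  obtain ⟨f, _, s, h, rfl⟩ := mem_macaulayRows.1 hp
  exact (totalDegree_monomial_mul_le s f).trans h

theorem polyOfRow_macaulayMatrix (d : ℕ) (F : List (MvPolynomial (Fin n) k))
    (i : Fin (macaulayRows d F).length) :
    polyOfRow n d k (macaulayMatrix d F i) = (macaulayRows d F).get i :=
  polyOfRow_coeff (totalDegree_le_of_mem_macaulayRows (List.get_mem _ i))

theorem length_macaulayRows_le (d : ℕ) (F : List (MvPolynomial (Fin n) k)) :
    (macaulayRows d F).length ≤ F.length * (drlMonomials n d).length := by
  rw [macaulayRows, List.length_flatMap]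
  refine (List.sum_le_card_nsmul _ (drlMonomials n d).length ?_).trans (by simp)
  intro x hx
  obtain ⟨f, _, rfl⟩ := List.mem_map.1 hx
  rw [List.length_map]
  exact List.length_filter_le _ _

/-- The columns are in descending order, so the first nonzero entry of a row sits at the largest
monomial. -/
theorem degree_polyOfRow_of_isLeadingEntry {ι : Type} {d : ℕ}
    {A : Matrix ι (Fin (drlMonomials n d).length) k} {i : ι}
    {c : Fin (drlMonomials n d).length} (h : A.IsLeadingEntry i c) :
    (drl n).degree (polyOfRow n d k (A i)) = (drlMonomials n d).get c := by
  apply (drl n).toSyn.injective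
  have hc : (polyOfRow n d k (A i)).coeff ((drlMonomials n d).get c) ≠ 0 := by
    rw [coeff_polyOfRow]; exact h.2
  refine le_antisymm ?_ ((drl n).le_degree (MvPolynomial.mem_support_iff.2 hc))
  rw [MonomialOrder.degree_le_iff]
  intro a ha
  obtain ⟨j, rfl⟩ := exists_get_of_coeff_polyOfRow (MvPolynomial.mem_support_iff.1 ha)
  rw [← not_lt, drlMonomials_get_lt_iff]
  intro hj
  rw [MvPolynomial.mem_support_iff, coeff_polyOfRow] at ha
  exact ha (h.1 j hj)

theorem isReducedSystem_of_isReducedRowEchelon {a d : ℕ}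
    [DecidablePred fun g : MvPolynomial (Fin n) k => g ≠ 0]
    {A : Matrix (Fin a) (Fin (drlMonomials n d).length) k} (hA : A.IsReducedRowEchelon) :
    IsReducedSystem (drl n)
      (((List.finRange a).map fun i => polyOfRow n d k (A i)).filter fun g => g ≠ 0) := by
  have hlead : ∀ i, polyOfRow n d k (A i) ≠ 0 → ∃ c, A.IsLeadingEntry i c := fun i hi =>
    Matrix.row_ne_zero_iff_exists_isLeadingEntry.1 fun h => hi (by rw [h, map_zero])
  have hmem : ∀ g ∈ ((List.finRange a).map fun i => polyOfRow n d k (A i)).filter fun g => g ≠ 0,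
      ∃ i c, A.IsLeadingEntry i c ∧ g = polyOfRow n d k (A i) := by
    intro g hg
    simp only [List.mem_filter, List.mem_map, List.mem_finRange, true_and, ne_eq,
      decide_eq_true_eq] at hg
    obtain ⟨⟨i, rfl⟩, h0⟩ := hg
    obtain ⟨c, hc⟩ := hlead i h0
    exact ⟨i, c, hc, rfl⟩
  refine ⟨?_, ?_, ?_⟩
  · intro g hg
    obtain ⟨i, c, hc, rfl⟩ := hmem g hg
    rw [MonomialOrder.leadingCoeff, degree_polyOfRow_of_isLeadingEntry hc, coeff_polyOfRow]
    exact hA.eq_one hc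
  · rw [List.pairwise_filter, List.pairwise_map]
    refine (List.pairwise_lt_finRange a).imp fun {i₁ i₂} hlt h₁ h₂ => ?_
    obtain ⟨c₁, hc₁⟩ := hlead i₁ (by simpa using h₁)
    obtain ⟨c₂, hc₂⟩ := hlead i₂ (by simpa using h₂)
    rw [degree_polyOfRow_of_isLeadingEntry hc₁, degree_polyOfRow_of_isLeadingEntry hc₂,
      drlMonomials_get_lt_iff]
    by_contra hle
    exact hc₂.2 (hA.isRowEchelon hlt fun j hj => hc₁.1 j (hj.trans_le (not_lt.1 hle)))
  · intro f hf g hg hne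
    obtain ⟨i, c, hc, rfl⟩ := hmem f hf
    obtain ⟨i', c', hc', rfl⟩ := hmem g hg
    rw [degree_polyOfRow_of_isLeadingEntry hc, coeff_polyOfRow]
    exact hA.eq_zero_of_ne_of_isLeadingEntry (fun e => hne (by rw [e])) hc

end MacaulayRows

/-! ### The rounds of the algorithm -/

namespace RowReduction

variable (E : RowReduction) {q n : ℕ} [Fact q.Prime]

open Classical in
theorem round_eq (d : ℕ) (F : List (MvPolynomial (Fin n) (ZMod q))) :
    E.round d F = ((List.finRange (macaulayRows d F).length).map fun i =>
      polyOfRow n d (ZMod q) (E.rref (macaulayMatrix d F) i)).filter fun g => g ≠ 0 := by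
  rw [round]
  congr 2
  funext i
  exact (polyOfRow_apply _).symm

theorem isReducedSystem_round (d : ℕ) (F : List (MvPolynomial (Fin n) (ZMod q))) :
    IsReducedSystem (drl n) (E.round d F) := by
  rw [round_eq]
  have h : (E.rref (macaulayMatrix d F)).IsReducedRowEchelon := E.isReducedRowEchelon q _ _ _
  exact isReducedSystem_of_isReducedRowEchelon h

theorem totalDegree_le_of_mem_round {d : ℕ} {F : List (MvPolynomial (Fin n) (ZMod q))}
    {g : MvPolynomial (Fin n) (ZMod q)} (hg : g ∈ E.round d F) : g.totalDegree ≤ d := by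
  rw [round_eq] at hg
  simp only [List.mem_filter, List.mem_map] at hg
  obtain ⟨⟨i, _, rfl⟩, _⟩ := hg
  exact totalDegree_polyOfRow_le _

theorem span_round (d : ℕ) (F : List (MvPolynomial (Fin n) (ZMod q))) :
    Submodule.span (ZMod q) {g | g ∈ E.round d F} =
      Submodule.span (ZMod q) {g | g ∈ macaulayRows d F} := by
  have h₁ : {g | g ∈ E.round d F} = Set.range (fun i =>
      polyOfRow n d (ZMod q) (E.rref (macaulayMatrix d F) i)) \ {0} := by
    ext g
    rw [round_eq]
    simp
  have h₂ : {g | g ∈ macaulayRows d F} = Set.range fun i =>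
      polyOfRow n d (ZMod q) (macaulayMatrix d F i) := by
    ext g
    simp only [polyOfRow_macaulayMatrix]
    exact List.mem_iff_get
  have h₃ : ∀ A : Matrix (Fin (macaulayRows d F).length) (Fin (drlMonomials n d).length) (ZMod q),
      Submodule.span (ZMod q) (Set.range fun i => polyOfRow n d (ZMod q) (A i)) =
        (Submodule.span (ZMod q) (Set.range fun i => A i)).map (polyOfRow n d (ZMod q)) := by
    intro A
    rw [Submodule.map_span, ← Set.range_comp]
    rfl
  rw [h₁, Submodule.span_sdiff_singleton_zero, h₂, h₃, h₃]
  congr 1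
  exact E.rowSpace_eq q _ _ (macaulayMatrix d F)

theorem span_le_span_round {d : ℕ} {F : List (MvPolynomial (Fin n) (ZMod q))}
    (hF : ∀ f ∈ F, f.totalDegree ≤ d) :
    Submodule.span (ZMod q) {g | g ∈ F} ≤ Submodule.span (ZMod q) {g | g ∈ E.round d F} := by
  rw [span_round]
  refine Submodule.span_mono fun f hf => mem_macaulayRows.2 ⟨f, hf, 0, by simpa using hF f hf, ?_⟩
  rw [MvPolynomial.monomial_zero', MvPolynomial.C_1, one_mul]

theorem round_subset_ideal (d : ℕ) (F : List (MvPolynomial (Fin n) (ZMod q)))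
    {I : Ideal (MvPolynomial (Fin n) (ZMod q))} (hF : ∀ f ∈ F, f ∈ I) :
    ∀ g ∈ E.round d F, g ∈ I := by
  intro g hg
  have h : g ∈ Submodule.span (ZMod q) {g | g ∈ macaulayRows d F} :=
    E.span_round d F ▸ Submodule.subset_span hg
  have hle : Submodule.span (ZMod q) {g | g ∈ macaulayRows d F} ≤
      I.restrictScalars (ZMod q) := by
    rw [Submodule.span_le]
    intro p hp
    obtain ⟨f, hf, s, _, rfl⟩ := mem_macaulayRows.1 hp
    exact I.mul_mem_left _ (hF f hf)
  exact hle h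

theorem system_succ (d : ℕ) (F : List (MvPolynomial (Fin n) (ZMod q))) (j : ℕ) :
    E.system d F (j + 1) = E.round d (E.system d F j) :=
  Function.iterate_succ_apply' _ _ _

theorem system_subset_ideal (d : ℕ) (F : List (MvPolynomial (Fin n) (ZMod q)))
    {I : Ideal (MvPolynomial (Fin n) (ZMod q))} (hF : ∀ f ∈ F, f ∈ I) (j : ℕ) :
    ∀ g ∈ E.system d F j, g ∈ I := by
  induction j with
  | zero => exact hF
  | succ j ih => rw [system_succ]; exact E.round_subset_ideal d _ ih

/-! ### Termination, and closure of the stable span under multiplication -/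

section Termination

variable {d : ℕ} {F : List (MvPolynomial (Fin n) (ZMod q))}

theorem totalDegree_le_of_mem_system (hF : ∀ f ∈ F, f.totalDegree ≤ d) (j : ℕ) :
    ∀ f ∈ E.system d F j, f.totalDegree ≤ d := by
  cases j with
  | zero => exact hF
  | succ j => rw [system_succ]; exact fun f hf => E.totalDegree_le_of_mem_round hf

theorem span_system_mono (hF : ∀ f ∈ F, f.totalDegree ≤ d) :
    Monotone fun j => Submodule.span (ZMod q) {g | g ∈ E.system d F j} := by
  refine monotone_nat_of_le_succ fun j => ?_
  rw [system_succ]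
  exact E.span_le_span_round (E.totalDegree_le_of_mem_system hF j)

theorem span_system_le (hF : ∀ f ∈ F, f.totalDegree ≤ d) (j : ℕ) :
    Submodule.span (ZMod q) {g | g ∈ E.system d F j} ≤
    LinearMap.range (polyOfRow n d (ZMod q)) := by
  rw [Submodule.span_le]
  exact fun f hf => ⟨_, polyOfRow_coeff (E.totalDegree_le_of_mem_system hF j f hf)⟩

/-- From the first round on, the systems are reduced, so a round that changes the system must
enlarge its span. The dimension is at most the number of columns. The input itself need not be
reduced, which accounts for the extra 1. -/
theorem exists_system_stable (hF : ∀ f ∈ F, f.totalDegree ≤ d) :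
    ∃ j ≤ (drlMonomials n d).length + 1, E.system d F (j + 1) = E.system d F j := by
  by_contra! hne
  have hlt : ∀ j ≤ (drlMonomials n d).length,
      Submodule.span (ZMod q) {g | g ∈ E.system d F (j + 1)} <
      Submodule.span (ZMod q) {g | g ∈ E.system d F (j + 2)} := by
    intro j hj
    refine lt_of_le_of_ne (E.span_system_mono hF (Nat.le_succ _)) fun h => ?_
    refine hne (j + 1) (by omega) (IsReducedSystem.eq_of_span_eq (ord := drl n) ?_ ?_ h.symm)
    · rw [system_succ]; exact E.isReducedSystem_round d _
    · rw [system_succ]; exact E.isReducedSystem_round d _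
  have hrank : ∀ j ≤ (drlMonomials n d).length + 1,
      j ≤ Module.finrank (ZMod q) (Submodule.span (ZMod q) {g | g ∈ E.system d F (j + 1)}) := by
    intro j
    induction j with
    | zero => simp
    | succ j ih =>
      intro hj
      have : FiniteDimensional (ZMod q) (Submodule.span (ZMod q) {g | g ∈ E.system d F (j + 2)}) :=
        FiniteDimensional.span_of_finite _ (List.finite_toSet _)
      have := Submodule.finrank_lt_finrank_of_lt (hlt j (by omega))
      exact Nat.succ_le_of_lt ((ih (by omega)).trans_lt this)
  have h₁ := hrank _ le_rfl
  have h₂ := Submodule.finrank_mono (E.span_system_le hF ((drlMonomials n d).length + 1 + 1))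
  have h₃ := LinearMap.finrank_range_le (polyOfRow n d (ZMod q))
  rw [Module.finrank_fin_fun] at h₃
  omega

theorem terminates (hF : ∀ f ∈ F, f.totalDegree ≤ d) : E.Terminates d F := by
  obtain ⟨j, _, hj⟩ := E.exists_system_stable hF
  exact ⟨j, hj⟩

theorem lastRound_le (hF : ∀ f ∈ F, f.totalDegree ≤ d) :
    E.lastRound d F ≤ (drlMonomials n d).length + 1 := by
  obtain ⟨j, hj, h⟩ := E.exists_system_stable hF
  exact (Nat.sInf_le h).trans hj

theorem round_output (hF : ∀ f ∈ F, f.totalDegree ≤ d) :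
    E.round d (E.output d F) = E.output d F := by
  have h : E.system d F (E.lastRound d F + 1) = E.system d F (E.lastRound d F) :=
    Nat.sInf_mem (E.terminates hF)
  rw [system_succ] at h
  exact h

theorem span_le_span_output (hF : ∀ f ∈ F, f.totalDegree ≤ d) :
    Submodule.span (ZMod q) {g | g ∈ F} ≤
    Submodule.span (ZMod q) {g | g ∈ E.output d F} := by
  have h₀ : E.system d F 0 = F := rfl
  have h := E.span_system_mono hF (Nat.zero_le (E.lastRound d F))
  simp only [h₀] at h
  exact h

theorem isReducedSystem_output (hF : ∀ f ∈ F, f.totalDegree ≤ d) :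
    IsReducedSystem (drl n) (E.output d F) := by
  rw [← E.round_output hF]
  exact E.isReducedSystem_round d _

/-- The degree condition on `h` passes to the basis elements: any `g` used in the reduced expansion
of `h` has its leading monomial in `h`, hence degree at most that of `h`. Its multiple is therefore
a Macaulay row, and stability puts the row back into the span. -/
theorem monomial_mul_mem_span_output (hF : ∀ f ∈ F, f.totalDegree ≤ d)
    {h : MvPolynomial (Fin n) (ZMod q)} {s : Fin n →₀ ℕ}
    (hh : h ∈ Submodule.span (ZMod q) {g | g ∈ E.output d F})
    (hs : s.degree + h.totalDegree ≤ d) :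
    MvPolynomial.monomial s 1 * h ∈ Submodule.span (ZMod q) {g | g ∈ E.output d F} := by
  classical
  rw [(E.isReducedSystem_output hF).eq_sum hh, Finset.mul_sum]
  refine Submodule.sum_mem _ fun g hg => ?_
  by_cases h0 : h.coeff ((drl n).degree g) = 0
  · simp [h0]
  · rw [mul_smul_comm]
    refine Submodule.smul_mem _ _ ?_
    have hdeg := degree_le_totalDegree h0
    rw [← totalDegree_eq_drl_degree] at hdeg
    have h₁ : MvPolynomial.monomial s 1 * g ∈ macaulayRows d (E.output d F) :=
      mem_macaulayRows.2 ⟨g, by simpa using hg, s, by omega, rfl⟩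
    have h₂ := E.span_round d (E.output d F)
    rw [E.round_output hF] at h₂
    rw [h₂]
    exact Submodule.subset_span h₁

theorem length_system_le (hF : ∀ f ∈ F, f.totalDegree ≤ d) (j : ℕ) :
    (E.system d F j).length ≤ max F.length (drlMonomials n d).length := by
  cases j with
  | zero => exact le_max_left _ _
  | succ j =>
    refine le_max_of_le_right (IsReducedSystem.length_le ?_ (E.totalDegree_le_of_mem_system hF _))
    rw [system_succ]
    exact E.isReducedSystem_round d _

end Termination

end RowReduction

/-! ### Gröbner bases from spaces of polynomials closed under multiplication -/

/-- The endomorphism algebra is not commutative, so evaluation takes place in the subalgebra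
generated by the commuting elements. -/
theorem exists_algHom_of_commute {n : ℕ} {k A : Type} [Field k] [Ring A] [Algebra k A]
    (M : Fin n → A) (h : ∀ i j, M i * M j = M j * M i) :
    ∃ φ : MvPolynomial (Fin n) k →ₐ[k] A, ∀ i, φ (MvPolynomial.X i) = M i := by
  have hc := Algebra.isMulCommutative_adjoin k (s := Set.range M) (by
    rintro _ ⟨i, rfl⟩ _ ⟨j, rfl⟩; exact h i j)
  let _ : CommRing (Algebra.adjoin k (Set.range M)) :=
    { (inferInstance : Ring (Algebra.adjoin k (Set.range M))) with
      mul_comm := fun a b => hc.is_comm.comm a b }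
  let ψ : MvPolynomial (Fin n) k →ₐ[k] Algebra.adjoin k (Set.range M) :=
    MvPolynomial.aeval fun i => ⟨M i, Algebra.subset_adjoin ⟨i, rfl⟩⟩
  refine ⟨(Algebra.adjoin k (Set.range M)).val.comp ψ, fun i => ?_⟩
  simp [ψ]

section ClosedSpaces

variable {n : ℕ} {k : Type} [Field k]

theorem totalDegree_X_mul_le (i : Fin n) (p : MvPolynomial (Fin n) k) :
    (MvPolynomial.X i * p).totalDegree ≤ p.totalDegree + 1 := by
  have := MvPolynomial.totalDegree_mul (MvPolynomial.X i) p
  rw [MvPolynomial.totalDegree_X] at this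
  omega

/-- The part of degree at most `e`. -/
noncomputable def truncDegree (n e : ℕ) (k : Type) [Field k] :
    MvPolynomial (Fin n) k →ₗ[k] MvPolynomial (Fin n) k :=
  ∑ j ∈ Finset.range (e + 1), MvPolynomial.homogeneousComponent j

theorem coeff_truncDegree (e : ℕ) (p : MvPolynomial (Fin n) k) (a : Fin n →₀ ℕ) :
    (truncDegree n e k p).coeff a = if a.degree ≤ e then p.coeff a else 0 := by
  rw [truncDegree, LinearMap.sum_apply, MvPolynomial.coeff_sum]
  simp_rw [MvPolynomial.coeff_homogeneousComponent]
  rw [Finset.sum_ite_eq]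
  simp

theorem totalDegree_truncDegree_le (e : ℕ) (p : MvPolynomial (Fin n) k) :
    (truncDegree n e k p).totalDegree ≤ e := by
  refine totalDegree_le_of_coeff fun a ha => ?_
  rw [coeff_truncDegree] at ha
  by_contra h
  exact ha (if_neg h)

theorem truncDegree_eq_self {e : ℕ} {p : MvPolynomial (Fin n) k} (hp : p.totalDegree ≤ e) :
    truncDegree n e k p = p := by
  ext a
  rw [coeff_truncDegree]
  split_ifs with h
  · rfl
  · by_contra h'
    exact h ((degree_le_totalDegree (Ne.symm h')).trans hp)

/-- Replacement of the monomials `u` of degree `e` by `u - g u`. -/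
noncomputable def reduceDegree (e : ℕ) (g : (Fin n →₀ ℕ) → MvPolynomial (Fin n) k) :
    MvPolynomial (Fin n) k →ₗ[k] MvPolynomial (Fin n) k :=
  LinearMap.id - ∑ u ∈ Finset.univ.finsuppAntidiag e, (MvPolynomial.lcoeff k u).smulRight (g u)

theorem reduceDegree_apply (e : ℕ) (g : (Fin n →₀ ℕ) → MvPolynomial (Fin n) k)
    (p : MvPolynomial (Fin n) k) :
    reduceDegree e g p = p - ∑ u ∈ Finset.univ.finsuppAntidiag e, p.coeff u • g u := by
  simp [reduceDegree, LinearMap.sum_apply, MvPolynomial.lcoeff]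

theorem mem_finsuppAntidiag_univ {e : ℕ} {u : Fin n →₀ ℕ} :
    u ∈ Finset.univ.finsuppAntidiag e ↔ u.degree = e := by
  rw [Finset.mem_finsuppAntidiag, Finsupp.degree_eq_sum]
  exact ⟨fun h => h.1, fun h => ⟨h, Finset.subset_univ _⟩⟩

theorem reduceDegree_eq_self {e : ℕ} {g : (Fin n →₀ ℕ) → MvPolynomial (Fin n) k}
    {p : MvPolynomial (Fin n) k} (hp : p.totalDegree < e) : reduceDegree e g p = p := by
  rw [reduceDegree_apply, Finset.sum_eq_zero, sub_zero]
  intro u hu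
  have : p.coeff u = 0 := by
    by_contra h
    have := degree_le_totalDegree h
    rw [mem_finsuppAntidiag_univ] at hu
    omega
  rw [this, zero_smul]

theorem sub_reduceDegree_mem {e : ℕ} {g : (Fin n →₀ ℕ) → MvPolynomial (Fin n) k}
    {V : Submodule k (MvPolynomial (Fin n) k)} (hg : ∀ u, u.degree = e → g u ∈ V)
    (p : MvPolynomial (Fin n) k) : p - reduceDegree e g p ∈ V := by
  rw [reduceDegree_apply, sub_sub_cancel]
  exact Submodule.sum_mem _ fun u hu =>
    Submodule.smul_mem _ _ (hg u (mem_finsuppAntidiag_univ.1 hu))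

/-- In degree `e + 1` and above each `g u` agrees with the monomial `u`, so the subtraction removes
exactly the top part of `p`. -/
theorem totalDegree_reduceDegree_le {e : ℕ} {g : (Fin n →₀ ℕ) → MvPolynomial (Fin n) k}
    (hg : ∀ u, u.degree = e + 1 → (g u - MvPolynomial.monomial u 1).totalDegree ≤ e)
    {p : MvPolynomial (Fin n) k} (hp : p.totalDegree ≤ e + 1) :
    (reduceDegree (e + 1) g p).totalDegree ≤ e := by
  classical
  refine totalDegree_le_of_coeff fun a ha => ?_
  by_contra! hlt
  apply ha
  have hga : ∀ u, u.degree = e + 1 → (g u).coeff a = if u = a then 1 else 0 := by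
    intro u hu
    rw [← MvPolynomial.coeff_monomial, ← sub_eq_zero, ← MvPolynomial.coeff_sub]
    by_contra h
    exact absurd (hg u hu) (not_le.2 (hlt.trans_le (degree_le_totalDegree h)))
  rw [reduceDegree_apply, MvPolynomial.coeff_sub, MvPolynomial.coeff_sum]
  simp_rw [MvPolynomial.coeff_smul, smul_eq_mul]
  rw [Finset.sum_congr rfl fun u hu => by rw [hga u (mem_finsuppAntidiag_univ.1 hu)]]
  simp_rw [mul_ite, mul_one, mul_zero]
  rw [Finset.sum_ite_eq']
  split_ifs with h
  · exact sub_self _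
  · rw [mem_finsuppAntidiag_univ] at h
    rw [sub_zero]
    by_contra h'
    have := degree_le_totalDegree h'
    omega

/-- Let `V` be a space of polynomials that is closed under multiplication by monomials up to
degree `d`, and that contains polynomials with top component `u` for all monomials `u` of degree
`e + 1 ≤ d`. If `e + 1 < d` or `e = 0`, then `V` contains all polynomials of degree at most `e` in
the ideal generated by elements of `V` of degree at most `e + 1`. -/
theorem mem_of_mem_ideal_of_totalDegree_le {V : Submodule k (MvPolynomial (Fin n) k)} {d e : ℕ}
    (hV : ∀ h ∈ V, ∀ s : Fin n →₀ ℕ, s.degree + h.totalDegree ≤ d →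
      MvPolynomial.monomial s 1 * h ∈ V)
    (hd : e + 1 ≤ d) (hd' : e + 1 < d ∨ e = 0) {g : (Fin n →₀ ℕ) → MvPolynomial (Fin n) k}
    (hgV : ∀ u, u.degree = e + 1 → g u ∈ V)
    (hg : ∀ u, u.degree = e + 1 → (g u - MvPolynomial.monomial u 1).totalDegree ≤ e)
    {F : Set (MvPolynomial (Fin n) k)} (hFV : ∀ f ∈ F, f ∈ V)
    (hF : ∀ f ∈ F, f.totalDegree ≤ e + 1)
    {p : MvPolynomial (Fin n) k} (hp : p ∈ Ideal.span F) (hpe : p.totalDegree ≤ e) : p ∈ V := by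
  have hX : ∀ i, ∀ h ∈ V, h.totalDegree + 1 ≤ d → MvPolynomial.X i * h ∈ V := fun i h hh hdeg =>
    hV h hh (Finsupp.single i 1) (by rw [Finsupp.degree_single]; omega)
  let ρ := reduceDegree (e + 1) g
  have hρV : ∀ p, p - ρ p ∈ V := sub_reduceDegree_mem hgV
  have hρ : ∀ p, p.totalDegree ≤ e + 1 → (ρ p).totalDegree ≤ e := fun p hp =>
    totalDegree_reduceDegree_le hg hp
  -- Multiplication by a variable followed by rewriting. The truncation makes the operators total,
  -- so that they act on a quotient of the whole polynomial ring; only polynomials of degree at most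
  -- `e` matter.
  let T : Fin n → MvPolynomial (Fin n) k →ₗ[k] MvPolynomial (Fin n) k := fun i =>
    ρ ∘ₗ LinearMap.mulLeft k (MvPolynomial.X i) ∘ₗ truncDegree n e k
  have hT : ∀ i p, T i p = ρ (MvPolynomial.X i * truncDegree n e k p) := fun i p => rfl
  have hTe : ∀ i p, (T i p).totalDegree ≤ e := fun i p => hρ _
    ((totalDegree_X_mul_le i _).trans (Nat.add_le_add_right (totalDegree_truncDegree_le e p) 1))
  let W : Submodule k (MvPolynomial (Fin n) k) := V ⊓ MvPolynomial.restrictTotalDegree (Fin n) k e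
  have hW : ∀ p, p ∈ W ↔ p ∈ V ∧ p.totalDegree ≤ e := fun p => by
    rw [Submodule.mem_inf, MvPolynomial.mem_restrictTotalDegree]
  have hTW : ∀ i, W ≤ W.comap (T i) := by
    intro i p hp
    rw [hW] at hp
    rw [Submodule.mem_comap, hW]
    refine ⟨?_, hTe i p⟩
    rw [hT, truncDegree_eq_self hp.2]
    have h₁ := hρV (MvPolynomial.X i * p)
    have h₂ := hX i p hp.1 (by omega)
    have := V.sub_mem h₂ h₁
    rwa [sub_sub_cancel] at this
  have hcomm : ∀ i j p, T i (T j p) - T j (T i p) ∈ V := by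
    rcases hd' with hlt | h0
    · have key : ∀ i j p, MvPolynomial.X i * (MvPolynomial.X j * truncDegree n e k p) -
          T i (T j p) ∈ V := by
        intro i j p
        have hq := totalDegree_truncDegree_le e p
        rw [hT i, truncDegree_eq_self (hTe j p)]
        have h₁ := hρV (MvPolynomial.X i * T j p)
        have h₂ : MvPolynomial.X j * truncDegree n e k p - T j p ∈ V := hρV _
        have hdeg : (MvPolynomial.X j * truncDegree n e k p - T j p).totalDegree ≤ e + 1 := by
          have h₃ := totalDegree_X_mul_le j (truncDegree n e k p)
          have h₄ := hTe j p
          have h₅ := MvPolynomial.totalDegree_sub (MvPolynomial.X j * truncDegree n e k p) (T j p)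
          exact h₅.trans (max_le (by omega) (by omega))
        -- The element has degree up to `e + 1`, so closure of `V` is needed here up to degree `e +
        -- 2`; this is where `e + 1 < d` enters.
        have h₃ := hX i _ h₂ (by omega)
        have h₄ := V.add_mem h₁ h₃
        rw [mul_sub] at h₄
        convert h₄ using 1
        ring
      intro i j p
      have := V.sub_mem (key j i p) (key i j p)
      convert this using 1
      ring
    · subst h0
      intro i j p
      -- For `e = 0` the operators act through the constant term alone, by scalars, and commute
      -- without any condition on `d`.
      have hconst : ∀ j p, T j p = p.coeff 0 • T j 1 := by
        intro j p
        have h₁ : truncDegree n 0 k p = p.coeff 0 • 1 := by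
          ext a
          rw [coeff_truncDegree, MvPolynomial.coeff_smul, MvPolynomial.coeff_one]
          by_cases h : a = 0
          · simp [h]
          · rw [if_neg (by rwa [Nat.le_zero, Finsupp.degree_eq_zero_iff]), if_neg (Ne.symm h), smul_zero]
        rw [hT, hT, h₁, truncDegree_eq_self (p := 1) (by simp), mul_smul_comm, map_smul]
      rw [hconst i, hconst j p, hconst j (T i p), hconst i p]
      simp only [MvPolynomial.coeff_smul, smul_eq_mul]
      have hc : ∀ i, T i 1 = MvPolynomial.C ((T i 1).coeff 0) := fun i =>
        MvPolynomial.totalDegree_eq_zero_iff_eq_C.1 (Nat.le_zero.1 (hTe i 1))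
      rw [hc i, hc j]
      simp only [MvPolynomial.smul_eq_C_mul, ← MvPolynomial.C_mul, MvPolynomial.coeff_C, if_true]
      rw [show MvPolynomial.coeff 0 p * (MvPolynomial.coeff 0 ((T j) 1)) *
          MvPolynomial.coeff 0 ((T i) 1) = MvPolynomial.coeff 0 p *
          (MvPolynomial.coeff 0 ((T i) 1)) * MvPolynomial.coeff 0 ((T j) 1) by ring, sub_self]
      exact V.zero_mem
  let M : Fin n → Module.End k (MvPolynomial (Fin n) k ⧸ W) := fun i => W.mapQ W (T i) (hTW i)
  have hM : ∀ i p, M i (W.mkQ p) = W.mkQ (T i p) := fun i p => rfl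
  obtain ⟨φ, hφ⟩ := exists_algHom_of_commute (k := k) M (by
    intro i j
    refine LinearMap.ext fun x => ?_
    obtain ⟨p, rfl⟩ := W.mkQ_surjective x
    rw [Module.End.mul_apply, Module.End.mul_apply, hM, hM, hM, hM, ← sub_eq_zero, ← map_sub,
      Submodule.mkQ_apply, Submodule.Quotient.mk_eq_zero, hW]
    exact ⟨hcomm i j p, (MvPolynomial.totalDegree_sub _ _).trans (max_le (hTe _ _) (hTe _ _))⟩)
  -- In the module defined by `φ`, acting on the class of 1 agrees with one rewriting step in all
  -- degrees up to `e + 1`: monomials of degree at most `e` are not rewritten, and one more variable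
  -- brings in a single `ρ`.
  have hmono : ∀ m ≤ e + 1, ∀ a : Fin n →₀ ℕ, a.degree = m →
      φ (MvPolynomial.monomial a 1) (W.mkQ 1) = W.mkQ (ρ (MvPolynomial.monomial a 1)) := by
    intro m
    induction m with
    | zero =>
      intro _ a ha
      have : a = 0 := (Finsupp.degree_eq_zero_iff a).1 ha
      subst this
      rw [MvPolynomial.monomial_zero', MvPolynomial.C_1, map_one, Module.End.one_apply]
      congr 1
      exact (reduceDegree_eq_self (by simp)).symm
    | succ m ih =>
      intro hm a ha
      have hne : a ≠ 0 := by rintro rfl; simp at ha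
      obtain ⟨i, hi⟩ := DFunLike.ne_iff.1 hne
      have hle : Finsupp.single i 1 ≤ a := Finsupp.single_le_iff.2 (Nat.one_le_iff_ne_zero.2 hi)
      obtain ⟨b, rfl⟩ := le_iff_exists_add.1 hle
      rw [map_add, Finsupp.degree_single] at ha
      have hb : b.degree = m := by omega
      have hbd : (MvPolynomial.monomial b (1 : k)).totalDegree ≤ e :=
        (show _ ≤ b.degree from MvPolynomial.totalDegree_monomial_le _ _).trans (by omega)
      have hmul : MvPolynomial.monomial (Finsupp.single i 1 + b) (1 : k) =
          MvPolynomial.X i * MvPolynomial.monomial b 1 := by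
        rw [MvPolynomial.X, MvPolynomial.monomial_mul, one_mul]
      have hred : ρ (MvPolynomial.monomial b 1) = MvPolynomial.monomial b 1 :=
        reduceDegree_eq_self (Nat.lt_succ_of_le hbd)
      rw [hmul, map_mul, Module.End.mul_apply, ih (by omega) b hb, hφ, hM, hT, hred,
        truncDegree_eq_self hbd]
  have hφρ : ∀ p : MvPolynomial (Fin n) k, p.totalDegree ≤ e + 1 →
      φ p (W.mkQ 1) = W.mkQ (ρ p) := by
    intro p hp
    rw [p.as_sum]
    simp only [map_sum, LinearMap.sum_apply]
    refine Finset.sum_congr rfl fun a ha => ?_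
    have h₁ : MvPolynomial.monomial a (p.coeff a) = p.coeff a • MvPolynomial.monomial a (1 : k) := by
      rw [MvPolynomial.smul_monomial, smul_eq_mul, mul_one]
    rw [h₁, map_smul, map_smul, map_smul, LinearMap.smul_apply, hmono _ _ a rfl]
    exact (degree_le_totalDegree (MvPolynomial.mem_support_iff.1 ha)).trans hp
  -- The annihilator of the class of 1 is an ideal, so it is enough to treat the generators; for `f`
  -- in `F` the rewritten `ρ f` lies in `V` and has degree at most `e`.
  have hker : ∀ p ∈ Ideal.span F, φ p (W.mkQ 1) = 0 := by
    intro p hp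
    induction hp using Submodule.span_induction with
    | mem f hf =>
      rw [hφρ f (hF f hf), Submodule.mkQ_apply, Submodule.Quotient.mk_eq_zero, hW]
      refine ⟨?_, hρ f (hF f hf)⟩
      have := V.sub_mem (hFV f hf) (hρV f)
      rwa [sub_sub_cancel] at this
    | zero => simp
    | add x y _ _ hx hy => rw [map_add, LinearMap.add_apply, hx, hy, add_zero]
    | smul a x _ hx => rw [smul_eq_mul, map_mul, Module.End.mul_apply, hx, map_zero]
  have hker := hker p hp
  rw [hφρ p (by omega), Submodule.mkQ_apply, Submodule.Quotient.mk_eq_zero, hW] at hker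
  have hred : ρ p = p := reduceDegree_eq_self (Nat.lt_succ_of_le hpe)
  rw [hred] at hker
  exact hker.1

/-! ### From top components to leading terms -/

theorem homogeneousComponent_monomial_mul_topComponent {D : ℕ} (s : Fin n →₀ ℕ) (c : k)
    (f : MvPolynomial (Fin n) k) :
    MvPolynomial.homogeneousComponent D (MvPolynomial.monomial s c * topComponent f) =
      if s.degree + f.totalDegree = D then
        MvPolynomial.homogeneousComponent D (MvPolynomial.monomial s c * f) else 0 := by
  ext a
  rw [apply_ite (MvPolynomial.coeff a)]
  simp only [MvPolynomial.coeff_homogeneousComponent, MvPolynomial.coeff_monomial_mul',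
    topComponent, MvPolynomial.coeff_zero]
  by_cases ha : a.degree = D
  · by_cases hs : s ≤ a
    · obtain ⟨b, rfl⟩ := le_iff_exists_add.1 hs
      rw [map_add] at ha
      simp only [add_tsub_cancel_left, map_add, ha, if_true, hs]
      by_cases hb : b.degree = f.totalDegree
      · rw [if_pos hb, if_pos (by omega)]
      · rw [if_neg hb, if_neg (by omega), mul_zero]
    · simp [hs]
  · simp [ha]

/-- The top components of the elements of a space closed under multiplication by monomials up to
degree `d`. -/
theorem exists_mem_of_mem_span_topComponent {V : Submodule k (MvPolynomial (Fin n) k)} {d D : ℕ}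
    (hV : ∀ h ∈ V, ∀ s : Fin n →₀ ℕ, s.degree + h.totalDegree ≤ d →
      MvPolynomial.monomial s 1 * h ∈ V) (hD : D ≤ d)
    {F : Set (MvPolynomial (Fin n) k)} (hFV : ∀ f ∈ F, f ∈ V) {p : MvPolynomial (Fin n) k}
    (hp : p ∈ Ideal.span (topComponent '' F)) :
    ∃ g ∈ V, g.totalDegree ≤ D ∧
      MvPolynomial.homogeneousComponent D g = MvPolynomial.homogeneousComponent D p := by
  let Q : Submodule k (MvPolynomial (Fin n) k) :=
    ((V ⊓ MvPolynomial.restrictTotalDegree (Fin n) k D).map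
      (MvPolynomial.homogeneousComponent D)).comap (MvPolynomial.homogeneousComponent D)
  -- `Q` is only a linear subspace; quantifying over all multiples of `p` lets the induction pass
  -- through the ideal generated by the top components.
  suffices h : ∀ h, h * p ∈ Q by
    obtain ⟨g, hg, hgp⟩ := h 1
    rw [one_mul] at hgp
    rw [SetLike.mem_coe, Submodule.mem_inf, MvPolynomial.mem_restrictTotalDegree] at hg
    exact ⟨g, hg.1, hg.2, hgp⟩
  induction hp using Submodule.span_induction with
  | mem t ht =>
    obtain ⟨f, hf, rfl⟩ := ht
    intro h
    induction h using MvPolynomial.induction_on' with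
    | monomial s c =>
      rw [Submodule.mem_comap, homogeneousComponent_monomial_mul_topComponent]
      split_ifs with hs
      · refine Submodule.mem_map_of_mem ?_
        have hc : MvPolynomial.monomial s c * f = c • (MvPolynomial.monomial s 1 * f) := by
          rw [← smul_mul_assoc, MvPolynomial.smul_monomial, smul_eq_mul, mul_one]
        rw [hc]
        refine Submodule.smul_mem _ _ ?_
        rw [Submodule.mem_inf, MvPolynomial.mem_restrictTotalDegree]
        exact ⟨hV f (hFV f hf) s (by omega), (totalDegree_monomial_mul_le s f).trans hs.le⟩
      · exact Submodule.zero_mem _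
    | add p q hp hq => rw [add_mul]; exact Q.add_mem hp hq
  | zero => intro h; rw [mul_zero]; exact Q.zero_mem
  | add x y _ _ hx hy => intro h; rw [mul_add]; exact Q.add_mem (hx h) (hy h)
  | smul a x _ hx => intro h; rw [smul_eq_mul, ← mul_assoc]; exact hx _

theorem totalDegree_sub_le_of_homogeneousComponent_eq {e : ℕ} {g p : MvPolynomial (Fin n) k}
    (hg : g.totalDegree ≤ e + 1) (hp : p.totalDegree ≤ e + 1)
    (h : MvPolynomial.homogeneousComponent (e + 1) g =
      MvPolynomial.homogeneousComponent (e + 1) p) : (g - p).totalDegree ≤ e := by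
  refine totalDegree_le_of_coeff fun a ha => ?_
  have h₁ := (degree_le_totalDegree ha).trans
    ((MvPolynomial.totalDegree_sub g p).trans (max_le hg hp))
  by_contra hlt
  have hae : a.degree = e + 1 := by omega
  have := congrArg (MvPolynomial.coeff a) h
  rw [MvPolynomial.coeff_homogeneousComponent, MvPolynomial.coeff_homogeneousComponent,
    if_pos hae, if_pos hae] at this
  rw [MvPolynomial.coeff_sub, this, sub_self] at ha
  exact ha rfl

/-- A reduced system whose span is closed under multiplication by monomials up to degree `d`, and
contains a system `F` with small degree of regularity, is a Gröbner basis of `(F)`. -/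
theorem isGroebnerBasis_of_closed {G : List (MvPolynomial (Fin n) k)}
    (hG : IsReducedSystem (drl n) G) {d e : ℕ}
    (hV : ∀ h ∈ Submodule.span k {g | g ∈ G}, ∀ s : Fin n →₀ ℕ, s.degree + h.totalDegree ≤ d →
      MvPolynomial.monomial s 1 * h ∈ Submodule.span k {g | g ∈ G})
    (hd : e + 1 ≤ d) (hd' : e + 1 < d ∨ e = 0) {F : Set (MvPolynomial (Fin n) k)}
    (hFV : ∀ f ∈ F, f ∈ Submodule.span k {g | g ∈ G}) (hF : ∀ f ∈ F, f.totalDegree ≤ e + 1)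
    (hreg : ∀ p : MvPolynomial (Fin n) k, p.IsHomogeneous (e + 1) →
      p ∈ Ideal.span (topComponent '' F))
    (hGI : ∀ g ∈ G, g ∈ Ideal.span F) :
    IsGroebnerBasis (drl n) {g | g ∈ G} (Ideal.span F) := by
  have hex : ∀ u : Fin n →₀ ℕ, ∃ g : MvPolynomial (Fin n) k, u.degree = e + 1 →
      g ∈ Submodule.span k {g | g ∈ G} ∧
        (g - MvPolynomial.monomial u 1).totalDegree ≤ e := by
    intro u
    by_cases hu : u.degree = e + 1
    · obtain ⟨g, hgV, hge, hgu⟩ := exists_mem_of_mem_span_topComponent hV hd hFV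
        (hreg (MvPolynomial.monomial u 1) (MvPolynomial.isHomogeneous_monomial 1 hu))
      refine ⟨g, fun _ => ⟨hgV, totalDegree_sub_le_of_homogeneousComponent_eq hge ?_ hgu⟩⟩
      exact (show _ ≤ u.degree from MvPolynomial.totalDegree_monomial_le _ _).trans hu.le
    · exact ⟨0, fun h => absurd h hu⟩
  choose g hg using hex
  have hspan : Ideal.span {g | g ∈ G} = Ideal.span F := by
    refine le_antisymm (Ideal.span_le.2 hGI) (Ideal.span_le.2 fun f hf => ?_)
    exact Submodule.span_le_restrictScalars k (MvPolynomial (Fin n) k) _ (hFV f hf)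
  refine ⟨List.finite_toSet G, hspan, le_antisymm ?_ ?_⟩
  · exact Ideal.span_mono (Set.image_mono hGI)
  · rw [Ideal.span_le]
    rintro _ ⟨p, hp, rfl⟩
    have key : p ≠ 0 → ∃ f ∈ G, (drl n).degree f ≤ (drl n).degree p := by
      intro hp0
      by_cases hpe : p.totalDegree ≤ e
      · have := mem_of_mem_ideal_of_totalDegree_le hV hd hd' (fun u hu => (hg u hu).1)
          (fun u hu => (hg u hu).2) hFV hF hp hpe
        obtain ⟨f, hf, h⟩ := hG.exists_degree_eq this hp0
        exact ⟨f, hf, h.le⟩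
      · rw [totalDegree_eq_drl_degree] at hpe
        -- In high degree some monomial `u` of degree exactly `e + 1` divides the leading monomial
        -- of `p`. DRL compares degrees first, so `u` is the leading monomial of `g u`.
        obtain ⟨u, hu, hue⟩ := Finsupp.exists_le_degree_eq _ (e + 1) (not_le.1 hpe)
        have hc : ∀ a : Fin n →₀ ℕ, e < a.degree →
            (g u).coeff a = (MvPolynomial.monomial u (1 : k)).coeff a := by
          intro a ha
          rw [← sub_eq_zero, ← MvPolynomial.coeff_sub]
          by_contra h
          exact absurd (hg u hue).2 (not_le.2 (ha.trans_le (degree_le_totalDegree h)))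
        have hcu : (g u).coeff u ≠ 0 := by
          rw [hc u (by omega)]; simp
        have hdeg : (drl n).degree (g u) = u := by
          apply (drl n).toSyn.injective
          refine le_antisymm ?_ ((drl n).le_degree (MvPolynomial.mem_support_iff.2 hcu))
          rw [MonomialOrder.degree_le_iff]
          intro a ha
          rw [MvPolynomial.mem_support_iff] at ha
          by_cases hae : e < a.degree
          · rw [hc a hae, MvPolynomial.coeff_monomial] at ha
            have : u = a := by by_contra h; exact ha (if_neg h)
            rw [this]
          · exact ((drl_lt_iff a u).2 (Or.inl (by omega))).le
        obtain ⟨f, hf, h⟩ := hG.exists_degree_eq (hg u hue).1 (by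
          intro h0; rw [h0] at hcu; simp at hcu)
        exact ⟨f, hf, by rw [h, hdeg]; exact hu⟩
    by_cases hp0 : p = 0
    · rw [hp0]; simp
    · obtain ⟨f, hf, hle⟩ := key hp0
      obtain ⟨b, hb⟩ := le_iff_exists_add.1 hle
      have : (drl n).leadingTerm p = MvPolynomial.monomial b ((drl n).leadingCoeff p) *
          (drl n).leadingTerm f := by
        rw [MonomialOrder.leadingTerm, MonomialOrder.leadingTerm, hG.monic f hf,
          MvPolynomial.monomial_mul, mul_one, hb, add_comm]
      rw [this]
      exact Ideal.mul_mem_left _ _ (Ideal.subset_span ⟨f, hf, rfl⟩)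

end ClosedSpaces

/-! ### LWE polynomials -/

section LinearForms

variable {n : ℕ} {k : Type} [Field k]

/-- The linear form with the given coefficients. -/
noncomputable def linForm (a : Fin n → k) : MvPolynomial (Fin n) k :=
  ∑ j, MvPolynomial.C (a j) * MvPolynomial.X j

theorem isHomogeneous_neg_linForm (a : Fin n → k) : (-linForm a).IsHomogeneous 1 := by
  refine MvPolynomial.IsHomogeneous.neg (MvPolynomial.IsHomogeneous.sum _ _ _ fun j _ => ?_)
  simpa using (MvPolynomial.isHomogeneous_C (Fin n) (a j)).mul (MvPolynomial.isHomogeneous_X k j)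

theorem linForm_ne_zero {a : Fin n → k} (ha : a ≠ 0) : linForm a ≠ 0 := by
  classical
  obtain ⟨j, hj⟩ := Function.ne_iff.1 ha
  intro h
  apply hj
  have := congrArg (MvPolynomial.coeff (Finsupp.single j 1)) h
  rw [linForm, MvPolynomial.coeff_sum, Finset.sum_eq_single j] at this
  · simpa using this
  · intro i _ hij
    rw [MvPolynomial.coeff_C_mul, MvPolynomial.coeff_X, if_neg, mul_zero]
    intro h
    exact hij ((Finsupp.single_left_inj one_ne_zero).1 h)
  · simp

theorem totalDegree_aeval_le {y : MvPolynomial (Fin n) k} (hy : y.IsHomogeneous 1)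
    (p : Polynomial k) : (Polynomial.aeval y p).totalDegree ≤ p.natDegree := by
  rw [Polynomial.aeval_eq_sum_range]
  refine MvPolynomial.totalDegree_finsetSum_le fun i hi => ?_
  refine (MvPolynomial.totalDegree_smul_le _ _).trans ?_
  have h := (hy.pow i).totalDegree_le
  rw [one_mul] at h
  exact h.trans (Nat.lt_succ_iff.1 (Finset.mem_range.1 hi))

theorem homogeneousComponent_aeval {y : MvPolynomial (Fin n) k} (hy : y.IsHomogeneous 1)
    (p : Polynomial k) :
    MvPolynomial.homogeneousComponent p.natDegree (Polynomial.aeval y p) =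
      p.leadingCoeff • y ^ p.natDegree := by
  rw [Polynomial.aeval_eq_sum_range, map_sum, Finset.sum_eq_single p.natDegree]
  · rw [map_smul, MvPolynomial.homogeneousComponent_of_mem (n := p.natDegree), if_pos rfl]
    · rfl
    · simpa using hy.pow p.natDegree
  · intro i _ hi
    rw [map_smul, MvPolynomial.homogeneousComponent_of_mem (n := i), if_neg hi.symm, smul_zero]
    simpa using hy.pow i
  · simp

/-- A Taylor shift absorbs the constant `c`, leaving an evaluation at a homogeneous form; the shift
changes neither degree nor leading coefficient. -/
theorem aeval_C_sub_eq (c : k) (l : MvPolynomial (Fin n) k) (p : Polynomial k) :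
    Polynomial.aeval (MvPolynomial.C c - l) p = Polynomial.aeval (-l) (Polynomial.taylor c p) := by
  rw [Polynomial.taylor_apply, Polynomial.aeval_comp]
  congr 1
  simp [sub_eq_neg_add, MvPolynomial.algebraMap_eq]

theorem totalDegree_aeval_C_sub_le (c : k) (a : Fin n → k) (p : Polynomial k) :
    (Polynomial.aeval (MvPolynomial.C c - linForm a) p).totalDegree ≤ p.natDegree := by
  rw [aeval_C_sub_eq, ← Polynomial.natDegree_taylor p c]
  exact totalDegree_aeval_le (isHomogeneous_neg_linForm a) _

theorem topComponent_aeval_C_sub (c : k) {a : Fin n → k} (ha : a ≠ 0) {p : Polynomial k}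
    (hp : p.Monic) : topComponent (Polynomial.aeval (MvPolynomial.C c - linForm a) p) =
      (-linForm a) ^ p.natDegree := by
  have h := homogeneousComponent_aeval (isHomogeneous_neg_linForm a) (Polynomial.taylor c p)
  rw [← aeval_C_sub_eq, Polynomial.natDegree_taylor, Polynomial.leadingCoeff_taylor,
    hp.leadingCoeff, one_smul] at h
  have hne : (-linForm a) ^ p.natDegree ≠ 0 := pow_ne_zero _ (neg_ne_zero.2 (linForm_ne_zero ha))
  have hdeg : (Polynomial.aeval (MvPolynomial.C c - linForm a) p).totalDegree = p.natDegree := by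
    refine le_antisymm (totalDegree_aeval_C_sub_le c a p) (not_lt.1 fun hlt => hne ?_)
    rw [← h]
    exact MvPolynomial.homogeneousComponent_eq_zero _ _ hlt
  rw [topComponent, hdeg, h]

theorem aeval_C_sub_linForm_zero (c : k) (p : Polynomial k) :
    Polynomial.aeval (MvPolynomial.C c - linForm (0 : Fin n → k)) p =
      MvPolynomial.C (p.eval c) := by
  have : linForm (0 : Fin n → k) = 0 := by simp [linForm]
  rw [this, sub_zero, ← MvPolynomial.algebraMap_eq, Polynomial.aeval_algebraMap_apply,
    Polynomial.coe_aeval_eq_eval]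

end LinearForms

/-! ### The polynomials of LWE samples and their degree of regularity -/

section LWESystem

variable {q : ℕ} [Fact q.Prime]

theorem lweErrorPoly_monic (q N : ℕ) [Fact q.Prime] : (lweErrorPoly q N).Monic :=
  Polynomial.monic_X.mul (Polynomial.monic_prod_of_monic _ _ fun _ _ =>
    (Polynomial.monic_X_add_C _).mul (Polynomial.monic_X_sub_C _))

theorem natDegree_lweErrorPoly (q N : ℕ) [Fact q.Prime] :
    (lweErrorPoly q N).natDegree = 2 * N + 1 := by
  have hm : ∀ i : ℕ, ((Polynomial.X + Polynomial.C (i : ZMod q)) *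
      (Polynomial.X - Polynomial.C (i : ZMod q))).Monic := fun i =>
    (Polynomial.monic_X_add_C _).mul (Polynomial.monic_X_sub_C _)
  rw [lweErrorPoly, Polynomial.monic_X.natDegree_mul
    (Polynomial.monic_prod_of_monic _ _ fun i _ => hm i),
    Polynomial.natDegree_prod_of_monic _ _ fun i _ => hm i]
  simp_rw [(Polynomial.monic_X_add_C _).natDegree_mul (Polynomial.monic_X_sub_C _),
    Polynomial.natDegree_X_add_C, Polynomial.natDegree_X_sub_C]
  simp
  ring

theorem eval_lweErrorPoly {N : ℕ} {e : ℤ} (he : |e| ≤ N) :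
    (lweErrorPoly q N).eval (e : ZMod q) = 0 := by
  rw [lweErrorPoly, Polynomial.eval_mul, Polynomial.eval_prod, Polynomial.eval_X]
  by_cases h0 : e = 0
  · simp [h0]
  · refine mul_eq_zero_of_right _ (Finset.prod_eq_zero (i := e.natAbs) ?_ ?_)
    · rw [Int.abs_eq_natAbs] at he; rw [Finset.mem_Icc]; omega
    · rw [Polynomial.eval_mul, Polynomial.eval_add, Polynomial.eval_sub, Polynomial.eval_X,
        Polynomial.eval_C]
      rcases Int.natAbs_eq e with h | h
      · refine mul_eq_zero_of_right _ ?_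
        rw [sub_eq_zero]
        conv_lhs => rw [h]
        simp
      · refine mul_eq_zero_of_left ?_ _
        rw [add_eq_zero_iff_eq_neg]
        conv_lhs => rw [h]
        simp

variable {n m N : ℕ}

theorem mem_lweSystem {S : Fin m → (Fin n → ZMod q) × ZMod q} {f : MvPolynomial (Fin n) (ZMod q)} :
    f ∈ lweSystem N S ↔ ∃ i, Polynomial.aeval (MvPolynomial.C (S i).2 - linForm (S i).1)
      (lweErrorPoly q N) = f := by
  rw [lweSystem, List.mem_ofFn]
  rfl

theorem length_lweSystem (S : Fin m → (Fin n → ZMod q) × ZMod q) :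
    (lweSystem N S).length = m := by
  rw [lweSystem, List.length_ofFn]

theorem totalDegree_le_of_mem_lweSystem {S : Fin m → (Fin n → ZMod q) × ZMod q} :
    ∀ f ∈ lweSystem N S, f.totalDegree ≤ 2 * N + 1 := by
  intro f hf
  obtain ⟨i, rfl⟩ := mem_lweSystem.1 hf
  rw [← natDegree_lweErrorPoly q N]
  exact totalDegree_aeval_C_sub_le _ _ _

theorem eval_eq_zero_of_mem_lweSystem {s : Fin n → ZMod q} {w : Fin m → (Fin n → ZMod q) × ℤ}
    (hw : ∀ i, |(w i).2| ≤ N) :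
    ∀ f ∈ lweSystem N (fun i => lweSample s (w i)), MvPolynomial.eval s f = 0 := by
  intro f hf
  obtain ⟨i, rfl⟩ := mem_lweSystem.1 hf
  rw [← MvPolynomial.coe_aeval_eq_eval, RingHom.coe_coe, ← Polynomial.aeval_algHom_apply]
  have : MvPolynomial.aeval s (MvPolynomial.C (lweSample s (w i)).2 -
      linForm (lweSample s (w i)).1) = ((w i).2 : ZMod q) := by
    simp [lweSample, linForm, dotProduct, mul_comm]
  rw [this, Polynomial.coe_aeval_eq_eval]
  exact eval_lweErrorPoly (hw i)

/-- The degree of regularity depends only on the vectors `aᵢ` if it is positive. -/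
theorem hasDegreeOfRegularity_lweSystem_of_fst_eq {S S' : Fin m → (Fin n → ZMod q) × ZMod q}
    {D : ℕ} (hD : 0 < D) (hS : HasDegreeOfRegularity {f | f ∈ lweSystem N S} D)
    (h₁ : ∀ i, (S' i).1 = (S i).1)
    (h₂ : ∀ i, (S' i).1 = 0 → (lweErrorPoly q N).eval (S' i).2 = 0) :
    HasDegreeOfRegularity {f | f ∈ lweSystem N S'} D := by
  have himg : ∀ S : Fin m → (Fin n → ZMod q) × ZMod q,
      topComponent '' {f | f ∈ lweSystem N S} = Set.range fun i => topComponent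
        (Polynomial.aeval (MvPolynomial.C (S i).2 - linForm (S i).1) (lweErrorPoly q N)) := by
    intro S
    ext f
    constructor
    · rintro ⟨g, hg, rfl⟩
      obtain ⟨i, rfl⟩ := mem_lweSystem.1 hg
      exact ⟨i, rfl⟩
    · rintro ⟨i, rfl⟩
      exact ⟨_, mem_lweSystem.2 ⟨i, rfl⟩, rfl⟩
  have hfun : (fun i => topComponent (Polynomial.aeval
      (MvPolynomial.C (S' i).2 - linForm (S' i).1) (lweErrorPoly q N))) = fun i => topComponent
        (Polynomial.aeval (MvPolynomial.C (S i).2 - linForm (S i).1) (lweErrorPoly q N)) := by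
    funext i
    rw [h₁ i]
    by_cases ha : (S i).1 = 0
    · rw [ha, aeval_C_sub_linForm_zero, aeval_C_sub_linForm_zero, h₂ i ((h₁ i).trans ha)]
      -- For `aᵢ = 0` the polynomial is a constant. Were it nonzero, it would be its own top
      -- component and generate the unit ideal, which forces regularity 0.
      suffices (lweErrorPoly q N).eval (S i).2 = 0 by rw [this]
      by_contra hne
      have hmem : MvPolynomial.C ((lweErrorPoly q N).eval (S i).2) ∈
          Ideal.span (topComponent '' {f | f ∈ lweSystem N S}) := by
        rw [himg]
        refine Ideal.subset_span ⟨i, ?_⟩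
        simp only [ha]
        rw [aeval_C_sub_linForm_zero, topComponent, MvPolynomial.totalDegree_C,
          MvPolynomial.homogeneousComponent_zero, MvPolynomial.coeff_C, if_pos rfl]
      have htop := Ideal.eq_top_of_isUnit_mem _ hmem ((Ne.isUnit hne).map MvPolynomial.C)
      have hle : D ≤ 0 := hS.2 fun p _ => htop ▸ Submodule.mem_top
      omega
    · rw [topComponent_aeval_C_sub _ ha (lweErrorPoly_monic q N),
        topComponent_aeval_C_sub _ ha (lweErrorPoly_monic q N)]
  unfold HasDegreeOfRegularity at hS ⊢
  rw [himg, hfun, ← himg]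
  exact hS

end LWESystem

/-! ### Bounds for binomial coefficients -/

/-- The coefficient is at most `(a + b) ^ a / a!`, and `a ^ a / a!` is at most `e ^ a`. -/
theorem choose_le_exp (a b : ℕ) (ha : 0 < a) :
    ((a + b).choose a : ℝ) ≤ Real.exp (a * (1 + Real.log ((a + b) / a))) := by
  have ha' : (0 : ℝ) < a := Nat.cast_pos.2 ha
  have hab : (0 : ℝ) < (a + b) / a := by positivity
  have h₁ : ((a + b).choose a : ℝ) ≤ ((a + b : ℕ) : ℝ) ^ a / a.factorial :=
    Nat.choose_le_pow_div a (a + b)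
  have h₂ : (a : ℝ) ^ a / a.factorial ≤ Real.exp a := Real.pow_div_factorial_le_exp _ ha'.le a
  have h₃ : Real.exp (a * (1 + Real.log ((a + b) / a))) =
      Real.exp a * ((a + b) / a : ℝ) ^ a := by
    rw [mul_add, mul_one, Real.exp_add, ← Real.log_pow, Real.exp_log (by positivity)]
  rw [h₃]
  refine h₁.trans ?_
  calc ((a + b : ℕ) : ℝ) ^ a / a.factorial
      = (a : ℝ) ^ a / a.factorial * ((a + b) / a : ℝ) ^ a := by
        rw [div_pow, div_mul_div_comm, mul_comm ((a : ℝ) ^ a), mul_div_mul_right _ _ (by positivity)]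
        push_cast
        rfl
    _ ≤ _ := by gcongr

theorem log_four_eq : Real.log 4 = 2 * Real.log 2 := by
  rw [show (4 : ℝ) = 2 ^ 2 by norm_num, Real.log_pow]
  norm_num

theorem one_div_log_four_bounds : 0.7213 < 1 / Real.log 4 ∧ 1 / Real.log 4 < 0.722 := by
  have h₁ := Real.log_two_gt_d9
  have h₂ := Real.log_two_lt_d9
  rw [log_four_eq]
  constructor
  · rw [lt_div_iff₀ (by linarith)]
    linarith
  · rw [div_lt_iff₀ (by linarith)]
    linarith

/-- The tangent bound `y ≤ exp (y - 1)` at `y = β (1 + log (1 + r))`, together with `log (1 + r) ≤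
log 2 + log r`, yields a multiple of `r ^ β`. The identity `β log 2 = log 2 - 1/2` evaluates the
constant, and the factor 1.15 covers what these two estimates lose. -/
theorem one_add_log_le {r : ℝ} (hr : 1 ≤ r) :
    1 + Real.log (1 + r) ≤ 1.15 * Real.exp 1 * Real.log 2 * r ^ (1 - 1 / Real.log 4) := by
  obtain ⟨hα, hα'⟩ := one_div_log_four_bounds
  have hl₁ := Real.log_two_gt_d9
  have hl₂ := Real.log_two_lt_d9
  set β := 1 - 1 / Real.log 4 with hβ
  have hβ0 : 0 < β := by linarith
  have hβl : β * Real.log 2 = Real.log 2 - 1 / 2 := by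
    rw [hβ, log_four_eq]
    field_simp
  have h₁ : β * (1 + Real.log (1 + r)) ≤ Real.exp (β * (1 + Real.log (1 + r)) - 1) := by
    have := Real.add_one_le_exp (β * (1 + Real.log (1 + r)) - 1)
    linarith
  have h₂ : Real.log (1 + r) ≤ Real.log 2 + Real.log r := by
    rw [← Real.log_mul (by norm_num) (by linarith)]
    exact Real.log_le_log (by linarith) (by linarith)
  have h₃ : Real.exp (β * (1 + Real.log (1 + r)) - 1) ≤
      Real.exp (β - 5 / 2) * (2 * Real.exp 1) * r ^ β := by
    have : Real.exp (β - 5 / 2) * (2 * Real.exp 1) * r ^ β =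
        Real.exp (β - 5 / 2 + (Real.log 2 + 1) + Real.log r * β) := by
      rw [Real.exp_add, Real.exp_add, Real.exp_add (Real.log 2), Real.exp_log (by norm_num),
        ← Real.rpow_def_of_pos (by linarith)]
    rw [this, Real.exp_le_exp]
    nlinarith [mul_le_mul_of_nonneg_left h₂ hβ0.le]
  have h₄ : Real.exp (β - 5 / 2) * 2 ≤ 1.15 * (β * Real.log 2) := by
    have he := Real.exp_one_gt_d9
    have h₅ : Real.exp (β - 5 / 2) ≤ Real.exp (-(2.22 : ℝ)) := Real.exp_le_exp.2 (by linarith)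
    have h₆ : (9.01 : ℝ) ≤ Real.exp 2.22 := by
      have h₇ : Real.exp 2.22 = Real.exp 1 * Real.exp 1 * Real.exp 0.22 := by
        rw [← Real.exp_add, ← Real.exp_add]; norm_num
      have h₈ := Real.add_one_le_exp (0.22 : ℝ)
      have h₉ : (7.389 : ℝ) ≤ Real.exp 1 * Real.exp 1 := by nlinarith
      rw [h₇]
      nlinarith
    rw [Real.exp_neg] at h₅
    have h₁₀ : (Real.exp 2.22)⁻¹ ≤ (9.01 : ℝ)⁻¹ := inv_anti₀ (by norm_num) h₆
    have h₁₁ : (9.01 : ℝ)⁻¹ < 0.111 := by norm_num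
    rw [hβl]
    linarith
  have hrβ : 0 < r ^ β := Real.rpow_pos_of_pos (by linarith) _
  refine le_of_mul_le_mul_left ?_ hβ0
  calc β * (1 + Real.log (1 + r)) ≤ Real.exp (β - 5 / 2) * 2 * (Real.exp 1 * r ^ β) := by
        linarith
    _ ≤ 1.15 * (β * Real.log 2) * (Real.exp 1 * r ^ β) := by gcongr
    _ = _ := by ring

/-- A bound for binomial coefficients in terms of weighted geometric means. -/
theorem choose_le_two_rpow (a b : ℕ) (ha : 0 < a) (hb : 0 < b) :
    ((a + b).choose a : ℝ) ≤ 2 ^ (1.15 * (Real.exp 1 *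
      (a : ℝ) ^ (1 / Real.log 4) * (b : ℝ) ^ (1 - 1 / Real.log 4))) := by
  obtain ⟨hα, hα'⟩ := one_div_log_four_bounds
  set α := 1 / Real.log 4
  have ha' : (0 : ℝ) < a := Nat.cast_pos.2 ha
  have hb' : (0 : ℝ) < b := Nat.cast_pos.2 hb
  have hl : 0 < Real.log 2 := Real.log_pos (by norm_num)
  rw [Real.rpow_def_of_pos (by norm_num)]
  have key : ∀ x y : ℝ, 0 < x → x ≤ y →
      x * (1 + Real.log ((x + y) / x)) ≤
        1.15 * Real.exp 1 * Real.log 2 * (x * (y / x) ^ (1 - α)) := by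
    intro x y hx hxy
    have := one_add_log_le (r := y / x) (by rwa [one_le_div hx])
    rw [show (x + y) / x = 1 + y / x by field_simp]
    calc _ ≤ x * (1.15 * Real.exp 1 * Real.log 2 * (y / x) ^ (1 - α)) := by gcongr
      _ = _ := by ring
  rcases le_total a b with hab | hab
  · refine (choose_le_exp a b ha).trans (Real.exp_le_exp.2 ?_)
    refine (key a b ha' (Nat.cast_le.2 hab)).trans (le_of_eq ?_)
    have : (a : ℝ) * ((b : ℝ) / a) ^ (1 - α) = (a : ℝ) ^ α * (b : ℝ) ^ (1 - α) := by
      rw [Real.div_rpow hb'.le ha'.le, mul_div_assoc', div_eq_iff (by positivity), mul_right_comm,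
        ← Real.rpow_add ha']
      simp
    rw [this]
    ring
  · have hsymm : (a + b).choose a = (b + a).choose b := by
      rw [add_comm b a, Nat.choose_symm_add]
    rw [hsymm]
    refine (choose_le_exp b a hb).trans (Real.exp_le_exp.2 ?_)
    refine (key b a hb' (Nat.cast_le.2 hab)).trans ?_
    -- With the roles exchanged the weights come out the wrong way round; since `a / b ≥ 1` and `α >
    -- 1/2`, the exponent may be raised from `1 - α` to `α`.
    have h₁ : ((a : ℝ) / b) ^ (1 - α) ≤ ((a : ℝ) / b) ^ α :=
      Real.rpow_le_rpow_of_exponent_le (by rw [one_le_div hb']; exact Nat.cast_le.2 hab)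
        (by linarith)
    have h₂ : (b : ℝ) * ((a : ℝ) / b) ^ α = (a : ℝ) ^ α * (b : ℝ) ^ (1 - α) := by
      rw [Real.div_rpow ha'.le hb'.le, mul_div_assoc', div_eq_iff (by positivity), mul_assoc,
        ← Real.rpow_add hb']
      simp [mul_comm]
    calc 1.15 * Real.exp 1 * Real.log 2 * (b * ((a : ℝ) / b) ^ (1 - α))
        ≤ 1.15 * Real.exp 1 * Real.log 2 * (b * ((a : ℝ) / b) ^ α) := by gcongr
      _ = _ := by rw [h₂]; ring

theorem two_rpow_one_div_log_two : (2 : ℝ) ^ (1 / Real.log 2) = Real.exp 1 := by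
  have hl : Real.log 2 ≠ 0 := (Real.log_pos (by norm_num)).ne'
  rw [Real.rpow_def_of_pos (by norm_num), mul_one_div_cancel hl]

/-- As `1 / log 4 > 1/2`, the exponent grows at least like `√D`, and the quartic term of the
exponential series in `√D` already yields `D ^ 2`. -/
theorem sq_le_two_rpow {D n : ℕ} (hD : 1 ≤ D) (hn : 2 ≤ n) :
    (D : ℝ) ^ 2 ≤ 1000 * 2 ^ (0.25 * (Real.exp 1 * (2 * D - 1 : ℝ) ^ (1 / Real.log 4) *
      (n - 1 : ℝ) ^ (1 - 1 / Real.log 4))) := by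
  obtain ⟨hα, hα'⟩ := one_div_log_four_bounds
  have hD' : (1 : ℝ) ≤ D := by exact_mod_cast hD
  have hn' : (2 : ℝ) ≤ n := by exact_mod_cast hn
  set X := Real.exp 1 * (2 * D - 1 : ℝ) ^ (1 / Real.log 4) *
      (n - 1 : ℝ) ^ (1 - 1 / Real.log 4) with hX
  have h₁ : Real.sqrt D ≤ (2 * D - 1 : ℝ) ^ (1 / Real.log 4) := by
    rw [Real.sqrt_eq_rpow]
    calc (D : ℝ) ^ (1 / 2 : ℝ) ≤ (2 * D - 1 : ℝ) ^ (1 / 2 : ℝ) :=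
          Real.rpow_le_rpow (by linarith) (by linarith) (by norm_num)
      _ ≤ _ := Real.rpow_le_rpow_of_exponent_le (by linarith) (by linarith)
  have h₂ : 1 ≤ (n - 1 : ℝ) ^ (1 - 1 / Real.log 4) :=
    Real.one_le_rpow (by linarith) (by linarith)
  have he := Real.exp_one_gt_d9
  have hl := Real.log_two_gt_d9
  have hs := Real.sqrt_nonneg (D : ℝ)
  have h₃ : 2.7 * Real.sqrt D ≤ X := by
    calc 2.7 * Real.sqrt D ≤ Real.exp 1 * (2 * D - 1 : ℝ) ^ (1 / Real.log 4) := by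
          gcongr; linarith
      _ ≤ X := le_mul_of_one_le_right
          (mul_nonneg (Real.exp_pos _).le (Real.rpow_nonneg (by linarith) _)) h₂
  have h₄ : 0.45 * Real.sqrt D ≤ Real.log 2 * (0.25 * X) := by nlinarith
  rw [Real.rpow_def_of_pos (by norm_num)]
  -- The constant 1000 exceeds `4! / 0.45 ^ 4`, which is about 585.
  have h₅ := Real.pow_div_factorial_le_exp (0.45 * Real.sqrt D) (by positivity) 4
  have h₆ : (0.45 * Real.sqrt D) ^ 4 = 0.45 ^ 4 * (D : ℝ) ^ 2 := by
    rw [mul_pow, show Real.sqrt D ^ 4 = (Real.sqrt D ^ 2) ^ 2 by ring, Real.sq_sqrt (by linarith)]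
  rw [h₆] at h₅
  have h₇ := Real.exp_le_exp.2 h₄
  norm_num [Nat.factorial] at h₅
  nlinarith

theorem length_drlMonomials_le {D n : ℕ} (hD : 1 ≤ D) (hn : 2 ≤ n) :
    ((drlMonomials n (2 * D - 1)).length : ℝ) ≤ 2 * D * 2 ^ (1.15 * (Real.exp 1 *
      (2 * D - 1 : ℝ) ^ (1 / Real.log 4) * (n - 1 : ℝ) ^ (1 - 1 / Real.log 4))) := by
  obtain ⟨n, rfl⟩ : ∃ n', n = n' + 1 := ⟨n - 1, by omega⟩
  rw [length_drlMonomials]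
  have h := choose_le_two_rpow (2 * D - 1) n (by omega) (by omega)
  have hc : ((2 * D - 1 : ℕ) : ℝ) = 2 * D - 1 := by
    rw [Nat.cast_sub (by omega)]; push_cast; ring
  rw [hc] at h
  have hn' : ((n + 1 : ℕ) : ℝ) - 1 = n := by push_cast; ring
  rw [hn']
  refine le_trans ?_ (mul_le_mul_of_nonneg_left h (by positivity))
  have h₁ := Nat.add_one_mul_choose_eq (2 * D - 1 + n) n
  have h₂ : (2 * D - 1 + n + 1).choose (n + 1) ≤ 2 * D * (2 * D - 1 + n).choose n := by
    have h₃ : 2 * D - 1 + n + 1 ≤ 2 * D * (n + 1) := by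
      rw [show 2 * D - 1 + n + 1 = 2 * D + n by omega]
      nlinarith
    refine Nat.le_of_mul_le_mul_right (c := n + 1) ?_ (by omega)
    rw [← h₁]
    calc _ ≤ 2 * D * (n + 1) * (2 * D - 1 + n).choose n := Nat.mul_le_mul_right _ h₃
      _ = _ := by ring
  rw [Nat.choose_symm_add]
  exact_mod_cast h₂

/-- Powers of the number of monomials of degree less than `2D`. -/
theorem length_drlMonomials_rpow_le {D n : ℕ} (hD : 1 ≤ D) (hn : 2 ≤ n) {p : ℝ} (hp : 0 ≤ p)
    (hp' : p ≤ 5) :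
    ((drlMonomials n (2 * D - 1)).length : ℝ) ^ p ≤ 32000 * ((D : ℝ) ^ 3 *
      2 ^ ((p + 1) * 2 ^ (1 / Real.log 2) *
        (2 * D - 1 : ℝ) ^ (1 / Real.log 4) * (n - 1 : ℝ) ^ (1 - 1 / Real.log 4))) := by
  have h₁ := length_drlMonomials_le hD hn
  have h₂ := sq_le_two_rpow hD hn
  have hD' : (1 : ℝ) ≤ D := by exact_mod_cast hD
  have hn' : (2 : ℝ) ≤ n := by exact_mod_cast hn
  rw [two_rpow_one_div_log_two]
  rw [mul_assoc ((p + 1) * Real.exp 1), mul_assoc (p + 1), ← mul_assoc (Real.exp 1)]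
  set X := Real.exp 1 * (2 * D - 1 : ℝ) ^ (1 / Real.log 4) *
      (n - 1 : ℝ) ^ (1 - 1 / Real.log 4) with hX
  have hX0 : 0 ≤ X := mul_nonneg (mul_nonneg (Real.exp_pos _).le
    (Real.rpow_nonneg (by linarith) _)) (Real.rpow_nonneg (by linarith) _)
  have h2D : (2 * D : ℝ) ^ p ≤ 32 * (D : ℝ) ^ 5 := by
    calc (2 * D : ℝ) ^ p ≤ (2 * D : ℝ) ^ (5 : ℝ) :=
          Real.rpow_le_rpow_of_exponent_le (by linarith) hp'
      _ = 32 * (D : ℝ) ^ 5 := by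
        rw [show (5 : ℝ) = (5 : ℕ) by norm_num, Real.rpow_natCast]; ring
  calc ((drlMonomials n (2 * D - 1)).length : ℝ) ^ p
      ≤ (2 * D * 2 ^ (1.15 * X)) ^ p := Real.rpow_le_rpow (by positivity) h₁ hp
    _ = (2 * D : ℝ) ^ p * 2 ^ (1.15 * X * p) := by
        rw [Real.mul_rpow (by positivity) (by positivity), ← Real.rpow_mul (by norm_num)]
    _ ≤ 32 * (D : ℝ) ^ 5 * 2 ^ (1.15 * X * p) := by gcongr
    _ = 32 * (D : ℝ) ^ 3 * ((D : ℝ) ^ 2 * 2 ^ (1.15 * X * p)) := by ring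
    _ ≤ 32 * (D : ℝ) ^ 3 * (1000 * 2 ^ (0.25 * X) * 2 ^ (1.15 * X * p)) := by gcongr
    _ = 32000 * ((D : ℝ) ^ 3 * 2 ^ (0.25 * X + 1.15 * X * p)) := by
        rw [Real.rpow_add (by norm_num)]; ring
    -- `0.25 + 1.15 p ≤ p + 1` holds exactly for `p ≤ 5`, and the time bound with `ω = 3` uses `p =
    -- 5`.
    _ ≤ 32000 * ((D : ℝ) ^ 3 * 2 ^ ((p + 1) * X)) := by
        gcongr
        · norm_num
        · nlinarith

/-! ### Complexity -/

/-- An instruction touches at most three registers, so memory is controlled by time and needs no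
assumption of its own on the elimination. -/
theorem ArithProg.card_registers_le {k o : Type} [Field k] [DecidableEq k] [Fintype o]
    (p : ArithProg k o) (ρ : ℕ → k) :
    (p.registers ρ).card ≤ 3 * p.steps ρ + Fintype.card o := by
  have h3 : ∀ r x y : ℕ, ({r, x, y} : Finset ℕ).card ≤ 3 := fun r x y => Finset.card_le_three
  induction p generalizing ρ with
  | halt out => simpa [registers, steps] using Finset.card_image_le (s := Finset.univ) (f := out)
  | const r c p ih =>
    have := ih (Function.update ρ r c)
    refine (Finset.card_union_le _ _).trans ?_
    simp only [Finset.card_singleton, steps]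
    omega
  | add r x y p ih | sub r x y p ih | mul r x y p ih | div r x y p ih =>
    refine (Finset.card_union_le _ _).trans ((Nat.add_le_add (h3 _ _ _) (ih _)).trans ?_)
    simp only [steps]
    omega
  | ifZero x p p' ih ih' =>
    refine (Finset.card_union_le _ _).trans ?_
    simp only [Finset.card_singleton, steps]
    split_ifs
    · have := ih ρ; omega
    · have := ih' ρ; omega

namespace RowReduction

variable (E : RowReduction) {q n : ℕ} [Fact q.Prime]

theorem space_le {a b : ℕ} (A : Matrix (Fin a) (Fin b) (ZMod q)) :
    E.space A ≤ 2 * (a * b) + 3 * E.steps A := by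
  have h₁ := ArithProg.card_registers_le (E.prog q a b) (loadMatrix A)
  rw [Fintype.card_prod, Fintype.card_fin, Fintype.card_fin] at h₁
  refine (Finset.card_union_le _ _).trans ?_
  rw [Finset.card_range]
  change _ ≤ 2 * (a * b) + 3 * (E.prog q a b).steps (loadMatrix A)
  omega

/-- Bounds for the cost of a round in terms of the number `L` of monomials. -/
theorem round_cost_le {ω c κ : ℝ} (hω : 2 ≤ ω) (hc : 0 ≤ c) (hκ : 0 ≤ κ)
    (hE : ∀ (a b : ℕ) (A : Matrix (Fin a) (Fin b) (ZMod q)),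
      (E.steps A : ℝ) ≤ c * a * b * (max A.rank 1 : ℝ) ^ (ω - 2))
    {d : ℕ} {F : List (MvPolynomial (Fin n) (ZMod q))}
    (hF : (F.length : ℝ) ≤ κ * (drlMonomials n d).length) :
    (E.roundTime d F : ℝ) ≤ (3 + c) * κ * ((drlMonomials n d).length : ℝ) ^ (ω + 1) ∧
    (E.roundSpace d F : ℝ) ≤ (3 + 3 * c) * κ * ((drlMonomials n d).length : ℝ) ^ (ω + 1) := by
  have hL : 1 ≤ (drlMonomials n d).length := by
    rw [length_drlMonomials]; exact Nat.choose_pos (by omega)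
  have hrows := length_macaulayRows_le d F
  have hspace := E.space_le (macaulayMatrix d F)
  have hsteps := hE _ _ (macaulayMatrix d F)
  have hrank : (macaulayMatrix d F).rank ≤ (drlMonomials n d).length := Matrix.rank_le_width _
  unfold roundTime roundSpace
  set L := (drlMonomials n d).length
  set R := (macaulayRows d F).length
  have hL' : (1 : ℝ) ≤ L := by exact_mod_cast hL
  have hR : (R : ℝ) ≤ κ * (L : ℝ) ^ 2 := by
    calc (R : ℝ) ≤ F.length * L := by exact_mod_cast hrows
      _ ≤ κ * L * L := by gcongr
      _ = _ := by ring
  have hpow : (L : ℝ) ^ 3 * (L : ℝ) ^ (ω - 2) = (L : ℝ) ^ (ω + 1) := by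
    rw [← Real.rpow_natCast, ← Real.rpow_add (by linarith)]
    congr 1
    push_cast
    ring
  have hrank' : (max (macaulayMatrix d F).rank 1 : ℝ) ^ (ω - 2) ≤ (L : ℝ) ^ (ω - 2) :=
    Real.rpow_le_rpow (by positivity) (max_le (by exact_mod_cast hrank) hL') (by linarith)
  have hs : (E.steps (macaulayMatrix d F) : ℝ) ≤ c * κ * (L : ℝ) ^ (ω + 1) := by
    calc (E.steps (macaulayMatrix d F) : ℝ)
        ≤ c * R * L * (max (macaulayMatrix d F).rank 1 : ℝ) ^ (ω - 2) := hsteps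
      _ ≤ c * (κ * (L : ℝ) ^ 2) * L * (L : ℝ) ^ (ω - 2) := by gcongr
      _ = c * κ * ((L : ℝ) ^ 3 * (L : ℝ) ^ (ω - 2)) := by ring
      _ = _ := by rw [hpow]
  have h3 : (L : ℝ) ^ 3 ≤ (L : ℝ) ^ (ω + 1) := by
    rw [← hpow]
    exact le_mul_of_one_le_right (by positivity) (Real.one_le_rpow hL' (by linarith))
  have hRL : (R : ℝ) * L ≤ κ * (L : ℝ) ^ (ω + 1) := by
    calc (R : ℝ) * L ≤ κ * (L : ℝ) ^ 2 * L := by gcongr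
      _ = κ * (L : ℝ) ^ 3 := by ring
      _ ≤ _ := by gcongr
  have hFL : (F.length : ℝ) * L ≤ κ * (L : ℝ) ^ (ω + 1) := by
    calc (F.length : ℝ) * L ≤ κ * L * L := by gcongr
      _ = κ * (L : ℝ) ^ 2 := by ring
      _ ≤ κ * (L : ℝ) ^ 3 := by gcongr; norm_num
      _ ≤ _ := by gcongr
  have hspace' : (E.space (macaulayMatrix d F) : ℝ) ≤
      2 * (R * L) + 3 * E.steps (macaulayMatrix d F) := by exact_mod_cast hspace
  push_cast
  constructor <;> linarith

theorem cost_le {ω c κ : ℝ} (hω : 2 ≤ ω) (hc : 0 ≤ c) (hκ : 1 ≤ κ)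
    (hE : ∀ (a b : ℕ) (A : Matrix (Fin a) (Fin b) (ZMod q)),
      (E.steps A : ℝ) ≤ c * a * b * (max A.rank 1 : ℝ) ^ (ω - 2))
    {d : ℕ} {F : List (MvPolynomial (Fin n) (ZMod q))} (hFd : ∀ f ∈ F, f.totalDegree ≤ d)
    (hF : (F.length : ℝ) ≤ κ * (drlMonomials n d).length) :
    (E.time d F : ℝ) ≤ 3 * (3 + c) * κ * ((drlMonomials n d).length : ℝ) ^ (ω + 2) ∧
    (E.memory d F : ℝ) ≤ (3 + 3 * c) * κ * ((drlMonomials n d).length : ℝ) ^ (ω + 1) := by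
  have hL : 1 ≤ (drlMonomials n d).length := by
    rw [length_drlMonomials]; exact Nat.choose_pos (by omega)
  have hL' : (1 : ℝ) ≤ (drlMonomials n d).length := by exact_mod_cast hL
  have hround := fun j => E.round_cost_le hω hc (zero_le_one.trans hκ) hE (d := d)
    (F := E.system d F j) (by
      refine (Nat.cast_le.2 (E.length_system_le hFd j)).trans ?_
      rw [Nat.cast_max]
      exact max_le hF (le_mul_of_one_le_left (by positivity) hκ))
  have hlast := E.lastRound_le hFd
  set L := (drlMonomials n d).length
  constructor
  · rw [time, Nat.cast_sum]
    refine (Finset.sum_le_card_nsmul _ _ _ fun j _ => (hround j).1).trans ?_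
    rw [Finset.card_range, nsmul_eq_mul]
    -- At most `L + 2` rounds are made, the one that detects stability included.
    have h₁ : ((E.lastRound d F + 1 : ℕ) : ℝ) ≤ 3 * L := by
      have : E.lastRound d F + 1 ≤ 3 * L := by omega
      exact_mod_cast this
    have h₂ : (L : ℝ) ^ (ω + 2) = L * (L : ℝ) ^ (ω + 1) := by
      rw [show ω + 2 = 1 + (ω + 1) by ring, Real.rpow_add (by linarith), Real.rpow_one]
    rw [h₂]
    calc _ ≤ 3 * L * ((3 + c) * κ * (L : ℝ) ^ (ω + 1)) := by gcongr
      _ = _ := by ring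
  · have h : E.memory d F ≤ ⌊(3 + 3 * c) * κ * (L : ℝ) ^ (ω + 1)⌋₊ :=
      Finset.sup_le fun j _ => Nat.le_floor (hround j).2
    exact (Nat.cast_le.2 h).trans (Nat.floor_le (by positivity))

end RowReduction

theorem choose_le_length_drlMonomials {D n : ℕ} (hD : 1 ≤ D) (hn : 2 ≤ n) :
    (n + D - 1).choose D ≤ (drlMonomials n (2 * D - 1)).length := by
  obtain ⟨n, rfl⟩ : ∃ n', n = n' + 1 := ⟨n - 1, by omega⟩
  rw [length_drlMonomials]
  have h₁ : (n + 1 + D - 1).choose D = (n + D).choose n := by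
    rw [show n + 1 + D - 1 = n + D by omega, Nat.choose_symm_add]
  rw [h₁]
  calc (n + D).choose n ≤ (n + D + 1).choose (n + 1) := by
        rw [Nat.choose_succ_succ]; exact Nat.le_add_right _ _
    _ ≤ _ := Nat.choose_le_choose _ (by omega)

/-- The Gröbner basis algorithm on LWE systems. -/
theorem lwe_complexity {ω : ℝ} (hω : 2 ≤ ω) (hω' : ω ≤ 3)
    (E : RowReduction) (hE : E.HasExponent ω) (K : ℝ) :
    ∃ C : ℝ, ∀ (q : ℕ) [Fact q.Prime] (n m N D : ℕ), 2 ≤ n → D = 2 * N + 1 →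
      (m : ℝ) ≤ K * (n + D - 1).choose D →
      ∀ S : Fin m → (Fin n → ZMod q) × ZMod q,
        HasDegreeOfRegularity {f | f ∈ lweSystem N S} D →
        E.Terminates (2 * D - 1) (lweSystem N S) ∧
        IsGroebnerBasis (drl n) {g | g ∈ E.output (2 * D - 1) (lweSystem N S)}
          (Ideal.span {f | f ∈ lweSystem N S}) ∧
        (E.time (2 * D - 1) (lweSystem N S) : ℝ) ≤
          C * ((D : ℝ) ^ 3 * (2 : ℝ) ^ ((ω + 3) * (2 : ℝ) ^ (1 / Real.log 2) *
            (2 * D - 1 : ℝ) ^ (1 / Real.log 4) * (n - 1 : ℝ) ^ (1 - 1 / Real.log 4))) ∧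
        (E.memory (2 * D - 1) (lweSystem N S) : ℝ) ≤
          C * ((D : ℝ) ^ 3 * (2 : ℝ) ^ (5 * (2 : ℝ) ^ (1 / Real.log 2) *
            (2 * D - 1 : ℝ) ^ (1 / Real.log 4) * (n - 1 : ℝ) ^ (1 - 1 / Real.log 4))) := by
  obtain ⟨c₀, hc₀⟩ := hE
  set c := max c₀ 0 with hc
  set κ := max K 1 with hκ
  have hc0 : 0 ≤ c := le_max_right _ _
  have hκ1 : 1 ≤ κ := le_max_right _ _
  refine ⟨3 * (3 + 3 * c) * κ * 32000, fun q _ n m N D hn hD hm S hS => ?_⟩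
  have hEc : ∀ (a b : ℕ) (A : Matrix (Fin a) (Fin b) (ZMod q)),
      (E.steps A : ℝ) ≤ c * a * b * (max A.rank 1 : ℝ) ^ (ω - 2) := by
    intro a b A
    refine (hc₀ q a b A).trans ?_
    gcongr
    exact le_max_left _ _
  have hD1 : 1 ≤ D := by omega
  have hdeg : ∀ f ∈ lweSystem N S, f.totalDegree ≤ 2 * D - 1 := fun f hf =>
    (totalDegree_le_of_mem_lweSystem f hf).trans (by omega)
  have hlen : ((lweSystem N S).length : ℝ) ≤ κ * (drlMonomials n (2 * D - 1)).length := by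
    rw [length_lweSystem]
    calc (m : ℝ) ≤ K * (n + D - 1).choose D := hm
      _ ≤ κ * (n + D - 1).choose D := by gcongr; exact le_max_left _ _
      _ ≤ _ := by gcongr; exact choose_le_length_drlMonomials hD1 hn
  obtain ⟨htime, hmem⟩ := E.cost_le hω hc0 hκ1 hEc hdeg hlen
  have hL' : (1 : ℝ) ≤ (drlMonomials n (2 * D - 1)).length := by
    have : 1 ≤ (drlMonomials n (2 * D - 1)).length := by
      rw [length_drlMonomials]; exact Nat.choose_pos (by omega)
    exact_mod_cast this
  refine ⟨E.terminates hdeg, ?_, ?_, ?_⟩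
  · refine isGroebnerBasis_of_closed (E.isReducedSystem_output hdeg) (d := 2 * D - 1) (e := 2 * N)
      (fun h hh s hs => E.monomial_mul_mem_span_output hdeg hh hs) (by omega) (by omega)
      (fun f hf => E.span_le_span_output hdeg (Submodule.subset_span hf))
      totalDegree_le_of_mem_lweSystem ?_ ?_
    · rw [← hD]; exact hS.1
    · exact E.system_subset_ideal _ _ (fun f hf => Ideal.subset_span hf) _
  · have h := length_drlMonomials_rpow_le hD1 hn (p := ω + 2) (by linarith) (by linarith)
    rw [show ω + 2 + 1 = ω + 3 by ring] at h
    refine htime.trans ?_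
    calc _ ≤ 3 * (3 + c) * κ * _ := mul_le_mul_of_nonneg_left h (by positivity)
      _ ≤ 3 * (3 + 3 * c) * κ * _ := by gcongr; linarith
      _ = _ := by rw [← mul_assoc]
  -- `ω + 1 ≤ 4`, which makes the memory exponent independent of `ω`.
  · have h := length_drlMonomials_rpow_le hD1 hn (p := 4) (by norm_num) (by norm_num)
    rw [show (4 : ℝ) + 1 = 5 by norm_num] at h
    refine hmem.trans ?_
    calc _ ≤ (3 + 3 * c) * κ * ((drlMonomials n (2 * D - 1)).length : ℝ) ^ (4 : ℝ) := by
          gcongr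
          linarith
      _ ≤ (3 + 3 * c) * κ * _ := mul_le_mul_of_nonneg_left h (by positivity)
      _ ≤ 3 * (3 + 3 * c) * κ * _ := by
          gcongr
          linarith
      _ = _ := by rw [← mul_assoc]

/-! ### Success probability -/

/-- Chernoff's bound with parameters 1 and -1 for the two tails; the discretization cannot move a
value out of `[-N, N]`. -/
theorem gaussianError_real_ge {σ : ℝ≥0} {δ : ℝ → ℤ} (hδ : IsDiscretization δ) (N : ℕ) :
    1 - 2 * Real.exp (σ ^ 2 / 2) * Real.exp (-N) ≤
      (gaussianError σ δ).real {e | |e| ≤ N} := by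
  rw [gaussianError, map_measureReal_apply hδ.1 MeasurableSet.of_discrete]
  set γ := gaussianReal 0 (σ ^ 2)
  have h₁ := measure_ge_le_exp_mul_mgf (μ := γ) (X := id) (t := 1) N zero_le_one
    (integrable_exp_mul_gaussianReal 1)
  have h₂ := measure_le_le_exp_mul_mgf (μ := γ) (X := id) (t := -1) (-N) (by norm_num)
    (integrable_exp_mul_gaussianReal (-1))
  rw [mgf_id_gaussianReal] at h₁ h₂
  beta_reduce at h₁ h₂
  have hcov : (δ ⁻¹' {e | |e| ≤ N})ᶜ ⊆ {x : ℝ | (N : ℝ) ≤ id x} ∪ {x : ℝ | id x ≤ -(N : ℝ)} := by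
    intro x hx
    by_contra hcon
    simp only [Set.mem_union, Set.mem_ofPred_eq, id, not_or, not_le] at hcon
    exact hx (hδ.2 x N (abs_le.2 ⟨by linarith, by linarith⟩))
  have h₃ := (measureReal_mono hcov (measure_ne_top γ _)).trans (measureReal_union_le _ _)
  have hm : MeasurableSet (δ ⁻¹' {e | |e| ≤ N}) := hδ.1 MeasurableSet.of_discrete
  rw [probReal_compl_eq_one_sub hm] at h₃
  have h₄ : Real.exp (0 * 1 + ((σ ^ 2 : ℝ≥0) : ℝ) * 1 ^ 2 / 2) = Real.exp (σ ^ 2 / 2) := by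
    congr 1; push_cast; ring
  have h₅ : Real.exp (0 * -1 + ((σ ^ 2 : ℝ≥0) : ℝ) * (-1) ^ 2 / 2) = Real.exp (σ ^ 2 / 2) := by
    congr 1; push_cast; ring
  rw [h₄, show -1 * (N : ℝ) = -N by ring] at h₁
  rw [h₅, show - -1 * -(N : ℝ) = -N by ring] at h₂
  linarith

/-- In a product of finitely many copies of `α × β`, the first components are independent of the
event that all second components lie in `G`. -/
theorem measureReal_pi_prod_inter {α β : Type} [Finite α] [MeasurableSpace α]
    [MeasurableSingletonClass α] [MeasurableSpace β] (ν : Measure α) (χ : Measure β)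
    [IsProbabilityMeasure ν] [IsProbabilityMeasure χ] {m : ℕ} {G : Set β} (hG : MeasurableSet G)
    (R : Set (Fin m → α)) :
    (Measure.pi fun _ : Fin m => ν.prod χ).real
        ({w | (fun i => (w i).1) ∈ R} ∩ {w | ∀ i, (w i).2 ∈ G}) =
      χ.real G ^ m * (Measure.pi fun _ : Fin m => ν.prod χ).real {w | (fun i => (w i).1) ∈ R} := by
  classical
  have key : ∀ G : Set β, MeasurableSet G → (Measure.pi fun _ : Fin m => ν.prod χ).real
        ({w | (fun i => (w i).1) ∈ R} ∩ {w | ∀ i, (w i).2 ∈ G}) =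
      χ.real G ^ m * ∑ a ∈ R.toFinite.toFinset, ∏ i, ν.real {a i} := by
    intro G hG
    have hset : {w : Fin m → α × β | (fun i => (w i).1) ∈ R} ∩ {w | ∀ i, (w i).2 ∈ G} =
        ⋃ a ∈ R.toFinite.toFinset, Set.univ.pi fun i => {a i} ×ˢ G := by
      ext w
      simp only [Set.mem_inter_iff, Set.mem_ofPred_eq, Set.mem_iUnion, Set.Finite.mem_toFinset,
        Set.mem_pi, Set.mem_univ, true_imp_iff, Set.mem_prod, Set.mem_singleton_iff]
      constructor
      · rintro ⟨h₁, h₂⟩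
        exact ⟨_, h₁, fun i => ⟨rfl, h₂ i⟩⟩
      · rintro ⟨a, ha, h⟩
        have : (fun i => (w i).1) = a := funext fun i => (h i).1
        exact ⟨this ▸ ha, fun i => (h i).2⟩
    rw [hset, measureReal_biUnion_finset, Finset.mul_sum]
    · refine Finset.sum_congr rfl fun a _ => ?_
      rw [measureReal_def, Measure.pi_pi, ENNReal.toReal_prod]
      simp_rw [← measureReal_def, measureReal_prod_prod]
      rw [Finset.prod_mul_distrib, Finset.prod_const, Finset.card_univ, Fintype.card_fin, mul_comm]
    · intro a _ b _ hab
      refine Set.disjoint_left.2 fun w hw hw' => hab (funext fun i => ?_)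
      exact (hw i (Set.mem_univ i)).1.symm.trans (hw' i (Set.mem_univ i)).1
    · exact fun a _ => MeasurableSet.univ_pi fun i => (measurableSet_singleton _).prod hG
  -- With no restriction on the second components, the sum in `key` is identified as the probability
  -- of the event for `R`.
  have h := key Set.univ MeasurableSet.univ
  simp only [Set.mem_univ, implies_true, Set.ofPred_true, Set.inter_univ, probReal_univ, one_pow,
    one_mul] at h
  rw [key G hG, h]

/-- The polynomials vanishing at `s` form an ideal, and no round leaves an ideal containing the
input. -/
theorem lweSuccess_of_abs_le (E : RowReduction) {q n : ℕ} [Fact q.Prime] {m N d : ℕ}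
    {s : Fin n → ZMod q} {w : Fin m → (Fin n → ZMod q) × ℤ} (hw : ∀ i, |(w i).2| ≤ N) :
    w ∈ lweSuccess E m N d s := by
  refine ⟨hw, fun g hg => ?_⟩
  exact E.system_subset_ideal d _ (I := RingHom.ker (MvPolynomial.eval s))
    (fun f hf => eval_eq_zero_of_mem_lweSystem hw f hf) _ g hg

/-- Given that all errors are small with probability at least `1 - ε`, the algorithm succeeds with
at least this probability, also conditionally on the degree of regularity. -/
theorem lwe_success_of_pow_ge (E : RowReduction) {q n : ℕ} [Fact q.Prime] {m N D d : ℕ}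
    (hD : 0 < D) (s : Fin n → ZMod q) (χ : Measure ℤ) [IsProbabilityMeasure χ] {ε : ℝ}
    (hχ : 1 - ε ≤ χ.real {e | |e| ≤ N} ^ m) :
    1 - ε ≤ (lweChoices q n m χ).real (lweSuccess E m N d s) ∧
      (lweChoices q n m χ (lweRegular m N D s) ≠ 0 →
        1 - ε ≤ ((lweChoices q n m χ)[|lweRegular m N D s]).real (lweSuccess E m N d s)) := by
  have : IsProbabilityMeasure (uniformOn (Set.univ : Set (Fin n → ZMod q))) :=
    isProbabilityMeasure_uniformOn Set.finite_univ Set.univ_nonempty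
  have : IsProbabilityMeasure (lweChoices q n m χ) := by
    unfold lweChoices; infer_instance
  have hind : ∀ R : Set (Fin m → Fin n → ZMod q), (lweChoices q n m χ).real
      ({w | (fun i => (w i).1) ∈ R} ∩ {w | ∀ i, (w i).2 ∈ {e : ℤ | |e| ≤ N}}) =
      χ.real {e | |e| ≤ N} ^ m * (lweChoices q n m χ).real {w | (fun i => (w i).1) ∈ R} :=
    fun R => measureReal_pi_prod_inter _ χ MeasurableSet.of_discrete R
  constructor
  · have h := hind Set.univ
    simp only [Set.mem_univ, Set.ofPred_true, Set.univ_inter, probReal_univ, mul_one] at h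
    rw [← h] at hχ
    exact hχ.trans (measureReal_mono fun w hw => lweSuccess_of_abs_le E hw)
  · intro h0
    -- Regularity with all errors replaced by 0, an event in the `aᵢ` alone. It contains the regular
    -- outcomes, and within it small errors give both regularity and success. Independence then
    -- gives a conditional probability of at least the `m`-th power of the probability that one
    -- error is small.
    let R : Set (Fin m → Fin n → ZMod q) :=
      {a | HasDegreeOfRegularity {f | f ∈ lweSystem N fun i => lweSample s (a i, 0)} D}
    have herr : ∀ (w : Fin m → (Fin n → ZMod q) × ℤ), (∀ i, |(w i).2| ≤ N) → ∀ i,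
        (lweSample s (w i)).1 = 0 → (lweErrorPoly q N).eval (lweSample s (w i)).2 = 0 := by
      intro w hw i hi
      have h₁ : (w i).1 = 0 := hi
      have h₂ : (lweSample s (w i)).2 = ((w i).2 : ZMod q) := by simp [lweSample, h₁]
      rw [h₂]
      exact eval_lweErrorPoly (hw i)
    have hsub : lweRegular m N D s ⊆ {w | (fun i => (w i).1) ∈ R} := fun w hw =>
      hasDegreeOfRegularity_lweSystem_of_fst_eq hD hw (fun i => rfl)
        (herr (fun i => ((w i).1, 0)) fun i => by simp)
    have hsub' : {w | (fun i => (w i).1) ∈ R} ∩ {w | ∀ i, (w i).2 ∈ {e : ℤ | |e| ≤ N}} ⊆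
        lweRegular m N D s ∩ lweSuccess E m N d s := fun w hw =>
      ⟨hasDegreeOfRegularity_lweSystem_of_fst_eq hD hw.1 (fun i => rfl) (herr w hw.2),
        lweSuccess_of_abs_le E hw.2⟩
    have hpos : 0 < (lweChoices q n m χ).real (lweRegular m N D s) :=
      ENNReal.toReal_pos h0 (measure_ne_top _ _)
    have h₁ := measureReal_mono (μ := lweChoices q n m χ) hsub
    have h₂ := measureReal_mono (μ := lweChoices q n m χ) hsub'
    rw [hind R] at h₂
    rw [measureReal_def, cond_apply MeasurableSet.of_discrete, ENNReal.toReal_mul,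
      ENNReal.toReal_inv, ← measureReal_def, ← measureReal_def, inv_mul_eq_div, le_div_iff₀ hpos]
    refine le_trans ?_ h₂
    calc _ ≤ χ.real {e | |e| ≤ N} ^ m * (lweChoices q n m χ).real (lweRegular m N D s) := by gcongr
      _ ≤ _ := by gcongr

theorem lwe_success {n : ℕ} (hn : 2 ≤ n) {σ : ℝ≥0} (hσ : 0 < σ) {ε : ℝ} (hε : 0 < ε) (K : ℝ) :
    ∃ t₀ : ℝ, ∀ t : ℝ, t₀ ≤ t → ∀ (m N D : ℕ), t * σ = N → D = 2 * N + 1 →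
      (m : ℝ) ≤ K * (n + D - 1).choose D → ∀ δ : ℝ → ℤ, IsDiscretization δ →
        1 - ε ≤ (gaussianError σ δ).real {e | |e| ≤ N} ^ m := by
  set c : ℝ := |K| * 3 ^ (n - 1) * (2 * Real.exp (σ ^ 2 / 2)) with hc
  have hc0 : 0 ≤ c := by positivity
  have hlim : Filter.Tendsto (fun x : ℝ => c * (x ^ (n - 1) * Real.exp (-x))) Filter.atTop
      (nhds 0) := by
    simpa using (Real.tendsto_pow_mul_exp_neg_atTop_nhds_zero (n - 1)).const_mul c
  obtain ⟨x₀, hx₀⟩ := Filter.eventually_atTop.1 (hlim.eventually (gt_mem_nhds hε))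
  have hσ' : (0 : ℝ) < σ := hσ
  -- `N ≥ x₀` makes the tail estimate small; `N ≥ n` gives `n + D - 1 = n + 2N ≤ 3N`, which bounds
  -- the number of samples by a polynomial in `N`.
  refine ⟨max x₀ n / σ, fun t ht m N D hN hD hm δ hδ => ?_⟩
  rw [div_le_iff₀ hσ', hN] at ht
  have hxN := hx₀ N ((le_max_left _ _).trans ht)
  have hnN : (n : ℝ) ≤ N := (le_max_right _ _).trans ht
  have hprob := gaussianError_real_ge (σ := σ) hδ N
  have : IsProbabilityMeasure (gaussianError σ δ) :=
    Measure.isProbabilityMeasure_map hδ.1.aemeasurable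
  have hchoose : ((n + D - 1).choose D : ℝ) ≤ 3 ^ (n - 1) * (N : ℝ) ^ (n - 1) := by
    have h₁ : (n + D - 1).choose D = (n + D - 1).choose (n - 1) := by
      rw [← Nat.choose_symm (show D ≤ n + D - 1 by omega)]
      congr 1
      omega
    have h₂ : n + D - 1 ≤ 3 * N := by
      have : n ≤ N := by exact_mod_cast hnN
      omega
    have h₃ : (n + D - 1).choose D ≤ (3 * N) ^ (n - 1) := by
      rw [h₁]
      exact (Nat.choose_le_pow _ _).trans (Nat.pow_le_pow_left h₂ _)
    rw [← mul_pow]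
    exact_mod_cast h₃
  have hm' : (m : ℝ) * (2 * Real.exp (σ ^ 2 / 2) * Real.exp (-N)) ≤ ε := by
    refine le_trans ?_ hxN.le
    calc (m : ℝ) * (2 * Real.exp (σ ^ 2 / 2) * Real.exp (-N))
        ≤ (|K| * (3 ^ (n - 1) * (N : ℝ) ^ (n - 1))) *
            (2 * Real.exp (σ ^ 2 / 2) * Real.exp (-N)) := by
          gcongr
          refine hm.trans ?_
          gcongr
          exact le_abs_self K
      _ = _ := by rw [hc]; ring
  have hnn : 0 ≤ (gaussianError σ δ).real {e | |e| ≤ N} := measureReal_nonneg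
  -- Bernoulli's inequality.
  refine le_trans ?_ (one_add_mul_sub_le_pow (by linarith) m)
  have := mul_le_mul_of_nonneg_left hprob (Nat.cast_nonneg (α := ℝ) m)
  nlinarith

theorem mainTheorem8 (ω : ℝ) (hω : 2 ≤ ω) (hω' : ω ≤ 3)
    (E : RowReduction) (hE : E.HasExponent ω) (K : ℝ) :
    -- complexity, with `N = tσ`: `C` depends only on `ω`, `E` and the constant `K` in `m = O(·)`
    (∃ C : ℝ, ∀ (q : ℕ) [Fact q.Prime] (n m N D : ℕ), 2 ≤ n → D = 2 * N + 1 →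
      (m : ℝ) ≤ K * (n + D - 1).choose D →
      ∀ S : Fin m → (Fin n → ZMod q) × ZMod q,
        HasDegreeOfRegularity {f | f ∈ lweSystem N S} D →
        E.Terminates (2 * D - 1) (lweSystem N S) ∧
        IsGroebnerBasis (drl n) {g | g ∈ E.output (2 * D - 1) (lweSystem N S)}
          (Ideal.span {f | f ∈ lweSystem N S}) ∧
        (E.time (2 * D - 1) (lweSystem N S) : ℝ) ≤
          C * ((D : ℝ) ^ 3 * (2 : ℝ) ^ ((ω + 3) * (2 : ℝ) ^ (1 / Real.log 2) *
            (2 * D - 1 : ℝ) ^ (1 / Real.log 4) * (n - 1 : ℝ) ^ (1 - 1 / Real.log 4))) ∧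
        (E.memory (2 * D - 1) (lweSystem N S) : ℝ) ≤
          C * ((D : ℝ) ^ 3 * (2 : ℝ) ^ (5 * (2 : ℝ) ^ (1 / Real.log 2) *
            (2 * D - 1 : ℝ) ^ (1 / Real.log 4) * (n - 1 : ℝ) ^ (1 - 1 / Real.log 4)))) ∧
    -- success probability, for `t → ∞`, over all samples and given that `d_reg = D`
    (∀ (n : ℕ) (σ : ℝ≥0) (ε : ℝ), 2 ≤ n → 0 < σ → 0 < ε → ∃ t₀ : ℝ, ∀ t : ℝ, t₀ ≤ t →
      ∀ (q : ℕ) [Fact q.Prime] (m N D : ℕ), t * σ = N → D = 2 * N + 1 →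
      (m : ℝ) ≤ K * (n + D - 1).choose D →
      ∀ (s : Fin n → ZMod q) (δ : ℝ → ℤ), IsDiscretization δ →
        1 - ε ≤ (lweChoices q n m (gaussianError σ δ)).real (lweSuccess E m N (2 * D - 1) s) ∧
        (lweChoices q n m (gaussianError σ δ) (lweRegular m N D s) ≠ 0 →
          1 - ε ≤ ((lweChoices q n m (gaussianError σ δ))[|lweRegular m N D s]).real
            (lweSuccess E m N (2 * D - 1) s))) := by
  refine ⟨lwe_complexity hω hω' E hE K, fun n σ ε hn hσ hε => ?_⟩
  obtain ⟨t₀, ht₀⟩ := lwe_success hn hσ hε K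
  refine ⟨t₀, fun t ht q _ m N D hN hD hm s δ hδ => ?_⟩
  have : IsProbabilityMeasure (gaussianError σ δ) :=
    Measure.isProbabilityMeasure_map hδ.1.aemeasurable
  exact lwe_success_of_pow_ge E (by omega) s _ (ht₀ t ht m N D hN hD hm δ hδ)
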